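/- Let $G$ be a finite $(c,d)$-regular bipartite graph of girth $g$ (one part consists of vertices of degree $c$, the other of vertices of degree $d$), and let $\mathscr C = v_0v_1\cdots v_{i-1}v_0$ be a cycle of length $i$ in $G$ with $d(v_0)=c$. Let $k,l$ be integers with $1\le l\le k$ and $i+2k<2g$. A closed walk is \emph{cycle-free} if its edges span a graph without cycles. For $a\in\{c,d\}$ let $b_{a,n}$ be the number of closed cycle-free walks of length $n$ in $G$ starting at a fixed vertex of degree $a$ (for the lengths $n$ used below the statement holds for every choice of that vertex). Let $\mathcal T_{c,d}$ be the infinite rooted tree whose root has degree $c-1$ and whose vertices on levels $1,2,3,\dots$ have degrees $d,c,d,\dots$; let $t_{c,n}$ be the number of closed (cycle-free) walks of length $n$ in $\mathcal T_{c,d}$ starting at the root, and define $t_{d,n}$ in the same way from $\mathcal T_{d,c}$. For a vertex $z_0$, let $\Lambda^{z_0}_{v_0}(l)$ be the set of closed walks $\mathscr W$ of length $i+2k$ with initial vertex $z_0$ such that: $\mathscr W$ is not a cycle and contains all edges of $\mathscr C$; $\mathscr W$ goes around $\mathscr C$ in the direction $v_0,v_1,v_2,\dots$ (it takes more steps along $\mathscr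 C$ in this direction than in the opposite one); $z_0\notin\mathscr C$ and $d(z_0,v_0)=l$; and $v_0$ is the first vertex of $\mathscr C$ on $\mathscr W$. Let $N_l(v_0)$ be the set of vertices $z_0$ for which $\Lambda^{z_0}_{v_0}(l)\neq\emptyset$. Let $z_0\in N_l(v_0)$, let $z_0z_1\cdots z_{l-1}v_0$ be the path of length $l$ from $z_0$ to $v_0$, and let $$w_0,w_1,\dots,w_{i+2l}\;=\;z_0,\dots,z_{l-1},v_0,v_1,\dots,v_{i-1},v_0,z_{l-1},\dots,z_0 .$$ For $\mathscr W\in\Lambda^{z_0}_{v_0}(l)$ put $\tau_0=0$, and let $\tau_{j+1}$ be the first position after $\tau_j$ at which $\mathscr W$ is at $w_{j+1}$ ($0\le j<i+2l$). Let $\mathscr W_j$ be the part of $\mathscr W$ from position $\tau_j$ to position $\tau_{j+1}$ for $j<i+2l$, and $\mathscr W_{i+2l}$ the part from position $\tau_{i+2l}$ to the end. For nonnegative integers $s_0,\dots,s_{i+2l}$ with $s_0+\cdots+s_{i+2l}=k-l$, let $\Lambda^{z_0}_{v_0}(2s_0,\dots,2s_{i+2l})$ be the set of those $\mathscr W\in\Lambda^{z_0}_{v_0}(l)$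 for which these positions exist, $\ell(\mathscr W_j)=2s_j+1$ for $0\le j<i+2l$, and $\ell(\mathscr W_{i+2l})=2s_{i+2l}$. Then for every such $(s_0,\dots,s_{i+2l})$, $$|\Lambda^{z_0}_{v_0}(2s_0,\dots,2s_{i+2l})|=\begin{cases} b_{c,2s_{i+2l}}\displaystyle\prod_{j=0}^{\frac i2+l-1}t_{c,2s_{2j}}\,t_{d,2s_{2j+1}}, & l\text{ even},\\[2ex] b_{d,2s_{i+2l}}\displaystyle\prod_{j=0}^{\frac i2+l-1}t_{d,2s_{2j}}\,t_{c,2s_{2j+1}}, & l\text{ odd},\end{cases}$$ and moreover $$\Lambda^{z_0}_{v_0}(l)=\bigcup_{s_0+\cdots+s_{i+2l}=k-l}\Lambda^{z_0}_{v_0}(2s_0,\dots,2s_{i+2l}),\qquad |\Lambda^{z_0}_{v_0}(l)|=\sum_{s_0+\cdots+s_{i+2l}=k-l}|\Lambda^{z_0}_{v_0}(2s_0,\dots,2s_{i+2l})| .$$ -/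

import Mathlib

namespace BiregularWalks

/-- `G` is a `(c, d)`-regular bipartite graph with parts `A`, `B`: every edge joins `A` to `B`,
every vertex of `A` has degree `c` and every vertex of `B` has degree `d`. -/
structure IsBiregular {V : Type*} [Fintype V] (G : SimpleGraph V) [DecidableRel G.Adj]
    (A B : Set V) (c d : ℕ) : Prop where
  bipartite : G.IsBipartiteWith A B
  cover : A ∪ B = Set.univ
  degree_left : ∀ v ∈ A, G.degree v = c
  degree_right : ∀ v ∈ B, G.degree v = d

/-- The closed cycle-free walks of length `n` starting at `x`: closed walks whose edges
span a graph without cycles. -/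
def cycleFreeWalks {V : Type*} (G : SimpleGraph V) (x : V) (n : ℕ) : Set (G.Walk x x) :=
  {W | W.length = n ∧ (SimpleGraph.fromEdgeSet {e | e ∈ W.edges}).IsAcyclic}

/-- The number of closed cycle-free walks of length `n` starting at `x`. -/
noncomputable def cycleFreeCount {V : Type*} (G : SimpleGraph V) (x : V) (n : ℕ) : ℕ :=
  (cycleFreeWalks G x n).ncard

/-- The words that name the vertices of the related tree. The empty word is the root, `a :: w` is
the `a`-th child of `w`; a vertex of even level has `c - 1` children, one of odd level has
`d - 1` children. -/
def IsTreeWord (c d : ℕ) : List ℕ → Prop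
  | [] => True
  | a :: w => IsTreeWord c d w ∧ a < (if Even w.length then c - 1 else d - 1)

/-- The vertices of the related tree. -/
def TreeVertex (c d : ℕ) : Type := {w : List ℕ // IsTreeWord c d w}

/-- The related tree `T_{c,d}`: the infinite rooted tree whose root has degree `c - 1` and whose
vertices on the levels `1, 2, 3, …` have degrees `d, c, d, …`. -/
def relatedTree (c d : ℕ) : SimpleGraph (TreeVertex c d) where
  Adj u w := (∃ a, w.1 = a :: u.1) ∨ (∃ a, u.1 = a :: w.1)
  symm := ⟨fun _ _ h => h.symm⟩
  loopless := ⟨fun u h => by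
    rcases h with ⟨a, h⟩ | ⟨a, h⟩ <;> exact List.cons_ne_self a u.1 h.symm⟩

/-- The root of the related tree. -/
def treeRoot (c d : ℕ) : TreeVertex c d := ⟨[], trivial⟩

/-- `t_{c,n}`: the number of closed cycle-free walks of length `n` starting at the root of
`T_{c,d}`. The number `t_{d,n}` is `treeCount d c n`. -/
noncomputable def treeCount (c d n : ℕ) : ℕ :=
  cycleFreeCount (relatedTree c d) (treeRoot c d) n

section

variable {V : Type*} {G : SimpleGraph V}

open Classical in
/-- `W` goes around the cycle `C` in the direction in which `C` itself is written: going through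
the walk `W`, steps along the cycle in the direction of `C` are more numerous than steps along the
cycle in the opposite direction. -/
def SameDirection {v z : V} (C : G.Walk v v) (W : G.Walk z z) : Prop :=
  W.darts.countP (fun e => e.symm ∈ C.darts) < W.darts.countP (fun e => e ∈ C.darts)

/-- `W` is a closed walk with cycle `C`, in the direction of `C`. -/
structure IsDirectedWalkWithCycle {v z : V} (C : G.Walk v v) (W : G.Walk z z) : Prop where
  not_isCycle : ¬ W.IsCycle
  edges_subset : C.edges ⊆ W.edges
  sameDirection : SameDirection C W

/-- The first vertex of the cycle `C` that appears in the walk `W` is `x`. -/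
def FirstVertexOn {v z : V} (C : G.Walk v v) (W : G.Walk z z) (x : V) : Prop :=
  x ∈ C.support ∧ ∃ n ≤ W.length, W.getVert n = x ∧ ∀ m < n, W.getVert m ∉ C.support

/-- The closed walks with initial vertex `z` and with cycle `C`, of length `i + 2k` where `i` is the
length of `C`, in the direction of `C`, such that `z` is not on `C`, `z` is at distance `l` from `x`
and `x` is the first vertex of `C` on the walk. -/
def outerWalks {v : V} (C : G.Walk v v) (k l : ℕ) (x z : V) : Set (G.Walk z z) :=
  {W | W.length = C.length + 2 * k ∧ IsDirectedWalkWithCycle C W ∧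
    z ∉ C.support ∧ G.dist z x = l ∧ FirstVertexOn C W x}

/-- `N_l(x)`: the initial vertices of the walks above. -/
def outerVertices {v : V} (C : G.Walk v v) (k l : ℕ) (x : V) : Set V :=
  {z | (outerWalks C k l x z).Nonempty}

/-- The walk that follows `p` from `z` to `v`, goes once around `C`, and returns along `p`. -/
def referenceWalk {v z : V} (C : G.Walk v v) (p : G.Walk z v) : G.Walk z z :=
  p.append (C.append p.reverse)

/-- The positions `τ 0 < τ 1 < … < τ N` in the walk `W` mark the vertices number `0, 1, …, N` of the
walk `R`: `τ 0 = 0`, and `τ (j + 1)` is the first position after `τ j` at which `W` is at the vertex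
number `j + 1` of `R`. -/
structure IsMarking {z : V} (R W : G.Walk z z) {N : ℕ} (τ : Fin (N + 1) → ℕ) : Prop where
  zero : τ 0 = 0
  lt : ∀ j : Fin N, τ j.castSucc < τ j.succ
  le_length : ∀ j : Fin (N + 1), τ j ≤ W.length
  getVert : ∀ j : Fin N, W.getVert (τ j.succ) = R.getVert (j + 1)
  first : ∀ (j : Fin N) (m : ℕ), τ j.castSucc < m → m < τ j.succ →
    W.getVert m ≠ R.getVert (j + 1)

/-- Cutting `W` at the marks gives `W = W_0 W_1 ⋯ W_N`, where `W_j` has length `2 s_j + 1` for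
`j < N` and `W_N`, which goes from the last mark to the end of `W`, has length `2 s_N`. -/
def HasBlocks {z : V} (R W : G.Walk z z) {N : ℕ} (s : Fin (N + 1) → ℕ) : Prop :=
  ∃ τ : Fin (N + 1) → ℕ, IsMarking R W τ ∧
    (∀ j : Fin N, τ j.succ = τ j.castSucc + (2 * s j.castSucc + 1)) ∧
    W.length = τ (Fin.last N) + 2 * s (Fin.last N)

/-- The walks of `outerWalks C k l v z` whose decomposition along the reference walk of `C` and `p`
has block lengths given by `s`. -/
def outerWalksWithBlocks {v z : V} (C : G.Walk v v) (p : G.Walk z v) (k l : ℕ) {N : ℕ}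
    (s : Fin (N + 1) → ℕ) : Set (G.Walk z z) :=
  {W ∈ outerWalks C k l v z | HasBlocks (referenceWalk C p) W s}

end

/-- `∏_{j = 0}^{i/2 + l - 1} t_{c, 2 s_{2j}} t_{d, 2 s_{2j+1}}`. -/
noncomputable def treeProduct (c d i l : ℕ) (s : Fin (i + 2 * l + 1) → ℕ) : ℕ :=
  ∏ j : Fin (i / 2 + l),
    treeCount c d (2 * s ⟨2 * j, by have := j.isLt; omega⟩) *
      treeCount d c (2 * s ⟨2 * j + 1, by have := j.isLt; omega⟩)

end BiregularWalks

/-! Write $g$ for the girth. Since $\mathscr C$ is a cycle, $g\le i$, so $i+2k<2g$ forces $2k<g$: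
every detour off the cycle is too short to close up a second cycle.

Removing backtracks from $W\in\Lambda$ leaves $qKq^{-1}$ with $K$ cyclically reduced, and length
below $2g$ makes $K$ a cycle. Signed traversal counts (`flow`) survive reduction. As $W$ has a
positive excess along $\mathscr C$, the cycle $K$ shares a directed edge with $\mathscr C$. If $K$
and $\mathscr C$ differed, some arc $\alpha$ of $\mathscr C$ would leave $K$. Its edges lie on $W$
with net flow zero, so each is traversed twice and $|W|\ge 2|\alpha|+|K|\ge 2g$, where the last
bound closes $\alpha$ up with both arcs of $K$ (`CyclesGE.two_mul_le_of_arc_disjoint`). So $K$ is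
$\mathscr C$, and the same bound forces $q$ to be the given path: $W$ reduces to the reference walk
(`CyclesGE.reduct_eq_referenceWalk`). Hence $W$ visits the reference vertices in order, and cutting
at greedy first visits gives the blocks, odd by bipartiteness. Conversely, every concatenation of
blocks lies in $\Lambda$ (`CyclesGE.mem_outerWalks`).

For the count, $2s_j+2\le 2(k-l)+2\le 2k<g$. A block from $u$ to its neighbour $w$ is therefore a
closed walk at $u$ avoiding $w$, followed by the step $uw$. Around $u$, the graph without $w$ looks
like the related tree (`IsBiregular.ncard_firstPassage`). The last block is any closed walk of
length below $g$. Degrees alternate along the reference walk, and the parity of $l$ fixes the degree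
at $z_0$. -/

namespace BiregularWalks

open SimpleGraph

/-! ### Girth bounds, walks without backtracking, reduction and flow. -/

section Core

variable {V : Type*} {G : SimpleGraph V}

/-- Every cycle of `G` has length at least `g`. -/
def CyclesGE (G : SimpleGraph V) (g : ℕ) : Prop :=
  ∀ ⦃v : V⦄ (c : G.Walk v v), c.IsCycle → g ≤ c.length

theorem cyclesGE_girth (G : SimpleGraph V) : CyclesGE G G.girth :=
  fun _ _ hc => girth_le_length hc

/-- Monotonicity is the reason for a predicate in place of `girth`: a subgraph may be acyclic, and
then its `girth` is the default value 0. -/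
theorem CyclesGE.anti {H : SimpleGraph V} {g : ℕ} (hg : CyclesGE G g) (hle : H ≤ G) :
    CyclesGE H g := fun _ c hc => by
  simpa using hg (c.mapLe hle) (hc.mapLe hle)

theorem CyclesGE.isAcyclic_of_length_lt {g : ℕ} (hg : CyclesGE G g) {l : List (Sym2 V)}
    (hl : ∀ e ∈ l, e ∈ G.edgeSet) (hlt : l.length < g) :
    (fromEdgeSet {e | e ∈ l}).IsAcyclic := by
  classical
  intro v c hc
  have hle : fromEdgeSet {e | e ∈ l} ≤ G := by
    intro a b hab
    rw [fromEdgeSet_adj] at hab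
    exact hl _ hab.1
  have h1 := hg (c.mapLe hle) (hc.mapLe hle)
  have h2 : c.edges.length ≤ l.length := by
    refine (List.subperm_of_subset hc.edges_nodup ?_).length_le
    intro e he
    have := c.edges_subset_edgeSet he
    rw [edgeSet_fromEdgeSet] at this
    exact this.1
  simp at h1 h2
  omega

/-- The two paths together use fewer than `g` edges, so they lie in a forest, where paths are
unique. -/
theorem CyclesGE.path_eq {g : ℕ} (hg : CyclesGE G g) {x y : V} {P Q : G.Walk x y}
    (hP : P.IsPath) (hQ : Q.IsPath) (hlt : P.length + Q.length < g) : P = Q := by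
  have hac := hg.isAcyclic_of_length_lt (l := P.edges ++ Q.edges)
    (by
      intro e he
      rcases List.mem_append.1 he with h | h
      · exact P.edges_subset_edgeSet h
      · exact Q.edges_subset_edgeSet h) (by simpa using hlt)
  have hmem : ∀ R : G.Walk x y, (∀ e ∈ R.edges, e ∈ P.edges ++ Q.edges) →
      ∀ e ∈ R.edges, e ∈ (fromEdgeSet {e | e ∈ P.edges ++ Q.edges}).edgeSet := by
    intro R hR e he
    rw [edgeSet_fromEdgeSet]
    exact ⟨hR e he, G.not_isDiag_of_mem_edgeSet (R.edges_subset_edgeSet he)⟩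
  have hP' := hmem P (fun e he => List.mem_append_left _ he)
  have hQ' := hmem Q (fun e he => List.mem_append_right _ he)
  have h := (hac.subsingleton_path x y).elim ⟨P.transfer _ hP', hP.transfer hP'⟩
    ⟨Q.transfer _ hQ', hQ.transfer hQ'⟩
  have h2 : P.transfer _ hP' = Q.transfer _ hQ' := congrArg Subtype.val h
  apply Walk.edges_injective
  rw [← P.edges_transfer hP', h2, Q.edges_transfer hQ']

/-- A walk without backtracking: consecutive edges are different. -/
def NB {u v : V} (W : G.Walk u v) : Prop := W.edges.IsChain (· ≠ ·)

theorem NB.append_left {u v w : V} {p : G.Walk u v} {q : G.Walk v w} (h : NB (p.append q)) :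
    NB p := by
  rw [NB, Walk.edges_append] at h
  exact (List.isChain_append.1 h).1

theorem NB.append_right {u v w : V} {p : G.Walk u v} {q : G.Walk v w} (h : NB (p.append q)) :
    NB q := by
  rw [NB, Walk.edges_append] at h
  exact (List.isChain_append.1 h).2.1

theorem nb_append_iff {u v w : V} {p : G.Walk u v} {q : G.Walk v w} :
    NB (p.append q) ↔ NB p ∧ NB q ∧
      ∀ e ∈ p.edges.getLast?, ∀ e' ∈ q.edges.head?, e ≠ e' := by
  rw [NB, Walk.edges_append, List.isChain_append]; rfl

theorem NB.reverse {u v : V} {p : G.Walk u v} (h : NB p) : NB p.reverse := by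
  rw [NB, Walk.edges_reverse, List.isChain_reverse]
  exact h.imp fun _ _ h => h.symm

theorem nb_nil {u : V} : NB (Walk.nil : G.Walk u u) := by simp [NB]

theorem mem_edges_path_ends {x y : V} {P : G.Walk x y} (hP : P.IsPath) (he : s(x, y) ∈ P.edges) :
    ∃ h : G.Adj x y, P = Walk.cons h Walk.nil := by
  cases P with
  | nil => simp at he
  | cons h p =>
    rw [Walk.edges_cons, List.mem_cons] at he
    rw [Walk.cons_isPath_iff] at hP
    rcases he with he | he
    · have : y = _ := Sym2.congr_right.1 he
      subst this
      obtain rfl := (Walk.isPath_iff_nil.1 hP.1).eq_nil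
      exact ⟨h, rfl⟩
    · exact absurd (p.fst_mem_support_of_mem_edges he) hP.2

/-- If the path after the first edge came back to `u`, its initial segment up to `u` and the
reversed first edge would be two short paths with the same ends. They coincide, which is a
backtrack. -/
theorem CyclesGE.isPath_of_nb {g : ℕ} (hg : CyclesGE G g) {u v : V} {W : G.Walk u v}
    (hW : NB W) (hlt : W.length < g) : W.IsPath := by
  classical
  induction W with
  | nil => simp
  | @cons u x v h p ih =>
    have hp : p.IsPath := ih (NB.append_right (p := Walk.cons h Walk.nil) hW)
      (by rw [Walk.length_cons] at hlt; omega)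
    rw [Walk.cons_isPath_iff]
    refine ⟨hp, fun hu => ?_⟩
    have h1 : (Walk.cons h.symm Walk.nil : G.Walk x u) = p.takeUntil u hu := by
      refine hg.path_eq ?_ (hp.takeUntil hu) ?_
      · simp [h.symm.ne]
      · have := p.length_takeUntil_le_length hu
        simp at hlt ⊢
        omega
    have h2 := p.take_spec hu
    rw [← h1] at h2
    rw [← h2, NB] at hW
    simp [Sym2.eq_swap] at hW

theorem CyclesGE.eq_nil_of_nb {g : ℕ} (hg : CyclesGE G g) {u : V} {W : G.Walk u u}
    (hW : NB W) (hlt : W.length < g) : W = Walk.nil :=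
  (Walk.isPath_iff_nil.1 (hg.isPath_of_nb hW hlt)).eq_nil

theorem IsPath.nb {u v : V} {W : G.Walk u v} (hW : W.IsPath) : NB W :=
  List.Pairwise.isChain hW.isTrail.edges_nodup

/-- The sum of `f` over the darts of a walk. -/
def flow (f : G.Dart → ℤ) {u v : V} (W : G.Walk u v) : ℤ := (W.darts.map f).sum

theorem flow_append (f : G.Dart → ℤ) {u v w : V} (p : G.Walk u v) (q : G.Walk v w) :
    flow f (p.append q) = flow f p + flow f q := by
  simp [flow]

theorem flow_reverse {f : G.Dart → ℤ} (hf : ∀ e, f e.symm = - f e) {u v : V} (p : G.Walk u v) :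
    flow f p.reverse = - flow f p := by
  induction p with
  | nil => simp [flow]
  | cons h p ih =>
    rw [Walk.reverse_cons, flow_append, ih]
    have := hf ⟨(_, _), h⟩
    simp only [Dart.symm] at this
    simp [flow]
    rw [← this]; rfl

/-- `W'` is obtained from `W` by removing backtracks. -/
structure Reduct {u v : V} (W W' : G.Walk u v) : Prop where
  nb : NB W'
  darts : W'.darts.Sublist W.darts
  flow : ∀ f : G.Dart → ℤ, (∀ e, f e.symm = - f e) → flow f W' = flow f W

theorem Reduct.length_le {u v : V} {W W' : G.Walk u v} (h : Reduct W W') :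
    W'.length ≤ W.length := by
  simpa using h.darts.length_le

theorem Reduct.support {u v : V} {W W' : G.Walk u v} (h : Reduct W W') :
    W'.support.Sublist W.support := by
  rw [← Walk.cons_map_snd_darts, ← Walk.cons_map_snd_darts]
  exact (h.darts.map _).cons_cons u

theorem Reduct.edges {u v : V} {W W' : G.Walk u v} (h : Reduct W W') :
    W'.edges.Sublist W.edges := h.darts.map _

/-- An edge put in front of a reduced walk either leaves it reduced or cancels its first edge; the
cancelled pair contributes opposite values to every antisymmetric `f`. -/
theorem exists_reduct {u v : V} (W : G.Walk u v) : ∃ W' : G.Walk u v, Reduct W W' := by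
  induction W with
  | nil => exact ⟨Walk.nil, nb_nil, List.Sublist.refl _, fun _ _ => rfl⟩
  | @cons u x v h p ih =>
    obtain ⟨p', hp'⟩ := ih
    by_cases hb : p'.edges.head? = some s(u, x)
    · cases p' with
      | nil => simp at hb
      | @cons _ y _ h' q =>
        simp only [Walk.edges_cons, List.head?_cons, Option.some.injEq] at hb
        have : y = u := by
          rw [Sym2.eq_swap] at hb
          exact Sym2.congr_left.1 hb
        subst this
        refine ⟨q, NB.append_right (p := Walk.cons h' Walk.nil) hp'.nb, ?_, ?_⟩
        · refine List.Sublist.trans ?_ ((hp'.darts).trans (List.sublist_cons_self _ _))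
          simp
        · intro f hf
          have h1 := hp'.flow f hf
          have h2 := hf ⟨(y, x), h⟩
          simp only [BiregularWalks.flow, Walk.darts_cons, List.map_cons, List.sum_cons] at h1 ⊢
          rw [← h1]
          simp only [Dart.symm, Prod.swap] at h2
          rw [h2]; ring
    · refine ⟨Walk.cons h p', ?_, ?_, ?_⟩
      · rw [NB, Walk.edges_cons, List.isChain_cons]
        refine ⟨fun e he => ?_, hp'.nb⟩
        rintro rfl
        exact hb he
      · exact hp'.darts.cons_cons _
      · intro f hf
        have h1 := hp'.flow f hf
        simp only [BiregularWalks.flow, Walk.darts_cons, List.map_cons, List.sum_cons] at h1 ⊢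
        rw [h1]

theorem CyclesGE.flow_eq_zero {g : ℕ} (hg : CyclesGE G g) {u : V} {W : G.Walk u u}
    (hlt : W.length < g) {f : G.Dart → ℤ} (hf : ∀ e, f e.symm = - f e) : flow f W = 0 := by
  obtain ⟨W', hW'⟩ := exists_reduct W
  rw [← hW'.flow f hf, hg.eq_nil_of_nb hW'.nb (hW'.length_le.trans_lt hlt)]
  rfl

/-- Cancellation of two walks without backtracking. -/
theorem exists_cancel {u v w : V} (a : G.Walk u v) (b : G.Walk v w) (ha : NB a) (hb : NB b) :
    ∃ (y : V) (e : G.Walk u y) (f : G.Walk y v) (r : G.Walk y w),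
      a = e.append f ∧ b = f.reverse.append r ∧ NB (e.append r) := by
  induction b generalizing u with
  | nil => exact ⟨_, a, Walk.nil, Walk.nil, by simp, by simp, by simpa using ha⟩
  | @cons v x w h p ih =>
    by_cases hl : a.edges.getLast? = some s(v, x)
    · induction a using Walk.concatRec with
      | Hnil => simp at hl
      | @Hconcat u t v a' h' _ =>
        have : t = x := by
          simp only [Walk.edges_concat, List.concat_eq_append, List.getLast?_append,
            List.getLast?_singleton, Option.some_or, Option.some.injEq] at hl
          rw [Sym2.eq_swap] at hl
          exact Sym2.congr_right.1 hl
        subst this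
        rw [Walk.concat_eq_append] at ha
        obtain ⟨y, e, f, r, h1, h2, h3⟩ := ih a' ha.append_left
          (NB.append_right (p := Walk.cons h Walk.nil) hb)
        refine ⟨y, e, f.concat h', r, ?_, ?_, h3⟩
        · rw [h1, Walk.append_concat]
        · rw [Walk.reverse_concat, Walk.cons_append, ← h2]
    · refine ⟨v, a, Walk.nil, Walk.cons h p, by simp, by simp, ?_⟩
      rw [nb_append_iff]
      refine ⟨ha, hb, fun e he e' he' => ?_⟩
      simp only [Walk.edges_cons, List.head?_cons, Option.mem_some_iff] at he'
      subst he'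
      rintro rfl
      exact hl he

end Core

/-! ### Cyclic reduction, arcs of cycles, and the bound on arcs leaving a cycle. -/

section Cycles

variable {V : Type*} {G : SimpleGraph V}

theorem exists_closed_subwalk {u v : V} (P : G.Walk u v) (hP : ¬ P.IsPath) :
    ∃ (y : V) (P₁ : G.Walk u y) (P₂ : G.Walk y y) (P₃ : G.Walk y v),
      P = P₁.append (P₂.append P₃) ∧ P₂.length ≠ 0 := by
  classical
  induction P with
  | nil => simp at hP
  | @cons u x v h p ih =>
    by_cases hp : p.IsPath
    · have hu : u ∈ p.support := by
        by_contra hu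
        exact hP ((Walk.cons_isPath_iff _ _).2 ⟨hp, hu⟩)
      refine ⟨u, Walk.nil, Walk.cons h (p.takeUntil u hu), p.dropUntil u hu, ?_, by simp⟩
      rw [Walk.nil_append, Walk.cons_append, p.take_spec hu]
    · obtain ⟨y, P₁, P₂, P₃, h1, h2⟩ := ih hp
      exact ⟨y, Walk.cons h P₁, P₂, P₃, by rw [h1, Walk.cons_append], h2⟩

/-- A closed walk without backtracking in the cyclic sense. -/
def CyclicNB {u : V} (K : G.Walk u u) : Prop :=
  NB K ∧ ∀ e ∈ K.edges.getLast?, ∀ e' ∈ K.edges.head?, e ≠ e'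

/-- A repeated vertex would cut `K` into two nonempty closed walks without backtracking (one passes
through the base point, where the cyclic condition is needed). Each has length at least `g`, too
much for `K`. -/
theorem CyclesGE.isCycle_of_cyclicNB {g : ℕ} (hg : CyclesGE G g) {u : V} {K : G.Walk u u}
    (hK : CyclicNB K) (hpos : K.length ≠ 0) (hlt : K.length < 2 * g) : K.IsCycle := by
  cases K with
  | nil => simp at hpos
  | @cons _ x _ h P =>
    have hP : P.IsPath := by
      by_contra hP
      obtain ⟨y, P₁, P₂, P₃, rfl, h2⟩ := exists_closed_subwalk P hP
      obtain ⟨hn, hc⟩ := hK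
      have hn' : NB ((Walk.cons h P₁).append (P₂.append P₃)) := by simpa using hn
      have e2 : g ≤ P₂.length := by
        by_contra hlt'
        have := hg.eq_nil_of_nb hn'.append_right.append_left (by omega)
        simp [this] at h2
      have e3 : g ≤ (P₃.append (Walk.cons h P₁)).length := by
        by_contra hlt'
        have hnb : NB (P₃.append (Walk.cons h P₁)) := by
          rw [nb_append_iff]
          refine ⟨hn'.append_right.append_right, hn'.append_left, ?_⟩
          intro e he e' he'
          apply hc e _ e' (by simpa using he')
          simp only [Walk.edges_cons, Walk.edges_append]
          rw [← List.cons_append, ← List.append_assoc, List.getLast?_append, he]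
          simp
        have := congrArg Walk.length (hg.eq_nil_of_nb hnb (by omega))
        simp at this
      simp at hlt e3
      omega
    rw [Walk.cons_isCycle_iff]
    refine ⟨hP, fun he => ?_⟩
    rw [Sym2.eq_swap] at he
    obtain ⟨h', rfl⟩ := mem_edges_path_ends hP he
    have := hK.1
    simp [NB, Sym2.eq_swap] at this

/-- As long as the first and the last edge agree, both are moved into the tail `q` and its reverse.
-/
theorem exists_cyclic_decomposition {z : V} (W : G.Walk z z) (hW : NB W) :
    ∃ (u : V) (q : G.Walk z u) (K : G.Walk u u),
      W = q.append (K.append q.reverse) ∧ CyclicNB K := by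
  induction hn : W.length using Nat.strong_induction_on generalizing z with
  | _ n ih =>
  subst hn
  by_cases hc : CyclicNB W
  · exact ⟨z, Walk.nil, W, by simp, hc⟩
  · simp only [CyclicNB, hW, true_and, not_forall, not_not] at hc
    obtain ⟨e, he, e', he', rfl⟩ := hc
    cases W with
    | nil => simp at he
    | @cons _ x _ h p =>
      induction p using Walk.concatRec with
      | Hnil => exact absurd rfl h.ne
      | @Hconcat x t z p' h' _ =>
        have hx : e = s(z, x) := by simpa using he'.symm
        have ht : e = s(t, z) := by
          simp only [Walk.edges_cons, Walk.edges_concat, List.concat_eq_append,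
            ← List.cons_append, List.getLast?_append, List.getLast?_singleton,
            Option.some_or, Option.mem_def, Option.some.injEq] at he
          exact he.symm
        have : x = t := by
          rw [hx, Sym2.eq_swap] at ht
          exact Sym2.congr_left.1 ht
        subst this
        have hp' : NB p' := by
          have := NB.append_right (p := Walk.cons h Walk.nil) hW
          exact this.append_left
        obtain ⟨u, q, K, h1, h2⟩ := ih p'.length (by simp) p' hp' rfl
        refine ⟨u, Walk.cons h q, K, ?_, h2⟩
        rw [h1]
        simp [Walk.concat_eq_append, ← Walk.append_assoc]

theorem exists_arc_prefix {u : V} (K : G.Walk u u) {x x' y : V} (h : G.Adj x x')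
    (P : G.Walk x' y) (hy : y ∈ K.support) (he : s(x, x') ∉ K.edges) :
    ∃ (z : V) (α : G.Walk x' z) (β : G.Walk z y), z ∈ K.support ∧ P = α.append β ∧
      ∀ e ∈ α.edges, e ∉ K.edges := by
  induction P generalizing x with
  | nil => exact ⟨_, Walk.nil, Walk.nil, hy, rfl, by simp⟩
  | @cons x' t y h' p ih =>
    by_cases hx : x' ∈ K.support
    · exact ⟨_, Walk.nil, Walk.cons h' p, hx, rfl, by simp⟩
    · have h2 : s(x', t) ∉ K.edges := fun h2 => hx (K.fst_mem_support_of_mem_edges h2)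
      obtain ⟨z, α, β, hz, hp, hα⟩ := ih h' hy h2
      refine ⟨z, Walk.cons h' α, β, hz, by rw [hp, Walk.cons_append], ?_⟩
      intro e he'
      rw [Walk.edges_cons, List.mem_cons] at he'
      rcases he' with rfl | he'
      · exact h2
      · exact hα e he'

theorem exists_arc {u : V} (K : G.Walk u u) {x y : V} (P : G.Walk x y) (hx : x ∈ K.support)
    (hy : y ∈ K.support) (hP : ∃ e ∈ P.edges, e ∉ K.edges) :
    ∃ (a b : V) (P₁ : G.Walk x a) (α : G.Walk a b) (P₂ : G.Walk b y),
      P = P₁.append (α.append P₂) ∧ a ∈ K.support ∧ b ∈ K.support ∧ α.length ≠ 0 ∧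
      ∀ e ∈ α.edges, e ∉ K.edges := by
  induction P with
  | nil => simp at hP
  | @cons x x' y h p ih =>
    by_cases he : s(x, x') ∈ K.edges
    · have hp : ∃ e ∈ p.edges, e ∉ K.edges := by
        obtain ⟨e, he1, he2⟩ := hP
        rw [Walk.edges_cons, List.mem_cons] at he1
        rcases he1 with rfl | he1
        · exact absurd he he2
        · exact ⟨e, he1, he2⟩
      obtain ⟨a, b, P₁, α, P₂, h1, h2⟩ := ih (K.snd_mem_support_of_mem_edges he) hy hp
      exact ⟨a, b, Walk.cons h P₁, α, P₂, by rw [h1, Walk.cons_append], h2⟩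
    · obtain ⟨z, α, β, hz, hp, hα⟩ := exists_arc_prefix K h p hy he
      refine ⟨x, z, Walk.nil, Walk.cons h α, β, by rw [hp]; simp, hx, hz, by simp, ?_⟩
      intro e he'
      rw [Walk.edges_cons, List.mem_cons] at he'
      rcases he' with rfl | he'
      · exact he
      · exact hα e he'

/-- The two arcs of a cycle between two of its vertices. -/
theorem exists_two_arcs {u : V} {K : G.Walk u u} (hK : K.IsCycle) {x y : V}
    (hx : x ∈ K.support) (hy : y ∈ K.support) (hxy : x ≠ y) :
    ∃ κ₁ κ₂ : G.Walk x y, κ₁.IsPath ∧ κ₂.IsPath ∧ κ₁.length + κ₂.length = K.length ∧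
      (∀ e ∈ κ₁.edges, e ∈ K.edges) ∧ (∀ e ∈ κ₂.edges, e ∈ K.edges) := by
  classical
  have hR := hK.rotate hx
  have hedges : ∀ e, e ∈ (K.rotate x hx).edges ↔ e ∈ K.edges := fun e =>
    (K.rotate_edges x hx).perm.mem_iff
  have hyR : y ∈ (K.rotate x hx).support := by
    rw [Walk.mem_support_rotate_iff]; exact hy
  set R := K.rotate x hx with hRdef
  have hs := R.take_spec hyR
  have hn1 : ¬ (R.takeUntil y hyR).Nil := fun h => hxy h.eq
  have hn2 : ¬ (R.dropUntil y hyR).Nil := fun h => hxy h.eq.symm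
  have hR' : ((R.takeUntil y hyR).append (R.dropUntil y hyR)).IsCycle := by rw [hs]; exact hR
  refine ⟨R.takeUntil y hyR, (R.dropUntil y hyR).reverse, hR'.isPath_of_append_left hn2,
    (hR'.isPath_of_append_right hn1).reverse, ?_, ?_, ?_⟩
  · have : R.length = K.length := by
      rw [← Walk.length_edges, ← Walk.length_edges]
      exact (K.rotate_edges x hx).perm.length_eq
    rw [← this, Walk.length_reverse, ← Walk.length_append, hs]
  · intro e he
    rw [← hedges, ← hs, Walk.edges_append]
    exact List.mem_append_left _ he
  · intro e he
    rw [← hedges, ← hs, Walk.edges_append]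
    exact List.mem_append_right _ (by simpa using he)

/-- The path differs from both arcs of `K` between its ends, so with each of them it has total
length at least `g`; the sum of the two inequalities is the claim. One edge off `K` is enough for
this. -/
theorem CyclesGE.two_mul_le_of_arc_disjoint {g : ℕ} (hg : CyclesGE G g) {u : V} {K : G.Walk u u}
    (hK : K.IsCycle) {x y : V} {α : G.Walk x y} (hx : x ∈ K.support) (hy : y ∈ K.support)
    (hα : α.IsPath) (hex : ∃ e ∈ α.edges, e ∉ K.edges) :
    2 * g ≤ 2 * α.length + K.length := by
  have hxy : x ≠ y := by
    rintro rfl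
    obtain ⟨e, he, -⟩ := hex
    rw [(Walk.isPath_iff_nil.1 hα).eq_nil] at he
    simp at he
  obtain ⟨κ₁, κ₂, h1, h2, h3, h4, h5⟩ := exists_two_arcs hK hx hy hxy
  obtain ⟨e, he1, he2⟩ := hex
  have a1 : g ≤ α.length + κ₁.length := by
    by_contra hlt
    have := hg.path_eq hα h1 (by omega)
    exact he2 (h4 e (this ▸ he1))
  have a2 : g ≤ α.length + κ₂.length := by
    by_contra hlt
    have := hg.path_eq hα h2 (by omega)
    exact he2 (h5 e (this ▸ he1))
  omega

theorem path_eq_of_edges_subset {x y : V} {P Q : G.Walk x y} (hP : P.IsPath) (hQ : Q.IsPath)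
    (h : ∀ e ∈ P.edges, e ∈ Q.edges) : P = Q := by
  induction P with
  | nil => rw [(Walk.isPath_iff_nil.1 hQ).eq_nil]
  | @cons x a y hxa p ih =>
    cases Q with
    | nil => exact absurd (h s(x, a) (by simp)) (by simp)
    | @cons _ b _ hxb q =>
      rw [Walk.cons_isPath_iff] at hP hQ
      have h1 := h s(x, a) (by simp)
      rw [Walk.edges_cons, List.mem_cons] at h1
      rcases h1 with h1 | h1
      · have : a = b := Sym2.congr_right.1 h1
        subst this
        congr 1
        refine ih hP.1 hQ.1 fun e he => ?_
        have h2 := h e (by simp [he])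
        rw [Walk.edges_cons, List.mem_cons] at h2
        rcases h2 with rfl | h2
        · exact absurd (p.fst_mem_support_of_mem_edges he) hP.2
        · exact h2
      · exact absurd (q.fst_mem_support_of_mem_edges h1) hQ.2

/-- Two prefixes of a walk are comparable. -/
theorem append_eq_append_cases {u v v' w : V} {a : G.Walk u v} {b : G.Walk v w}
    {a' : G.Walk u v'} {b' : G.Walk v' w} (h : a.append b = a'.append b') :
    (∃ m : G.Walk v' v, a = a'.append m ∧ b' = m.append b) ∨
      (∃ m : G.Walk v v', a' = a.append m ∧ b = m.append b') := by
  induction a with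
  | nil => exact Or.inr ⟨a', by simp, by simpa using h⟩
  | cons h1 a ih =>
    cases a' with
    | nil => exact Or.inl ⟨Walk.cons h1 a, by simp, by simpa using h.symm⟩
    | cons h2 a' =>
      rw [Walk.cons_append, Walk.cons_append, Walk.cons.injEq] at h
      obtain ⟨rfl, h⟩ := h
      rcases ih (eq_of_heq h) with ⟨m, rfl, h4⟩ | ⟨m, rfl, h4⟩
      · exact Or.inl ⟨m, by simp, h4⟩
      · exact Or.inr ⟨m, by simp, h4⟩

theorem IsPath.append_unique {u v w : V} {a a' : G.Walk u v} {b b' : G.Walk v w}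
    (hP : (a.append b).IsPath) (h : a.append b = a'.append b') : a = a' ∧ b = b' := by
  rcases append_eq_append_cases h with ⟨m, rfl, rfl⟩ | ⟨m, rfl, rfl⟩
  · have hm : m.IsPath := hP.of_append_left.of_append_right
    simp [(Walk.isPath_iff_nil.1 hm).eq_nil]
  · have hm : m.IsPath := hP.of_append_right.of_append_left
    simp [(Walk.isPath_iff_nil.1 hm).eq_nil]

theorem exists_split_at_dart {u v : V} {W : G.Walk u v} {e : G.Dart} (he : e ∈ W.darts) :
    ∃ (W₁ : G.Walk u e.fst) (W₂ : G.Walk e.snd v), W = W₁.append (Walk.cons e.adj W₂) := by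
  induction W with
  | nil => simp at he
  | cons h p ih =>
    rw [Walk.darts_cons, List.mem_cons] at he
    rcases he with rfl | he
    · exact ⟨Walk.nil, p, rfl⟩
    · obtain ⟨W₁, W₂, h1⟩ := ih he
      exact ⟨Walk.cons h W₁, W₂, by rw [h1, Walk.cons_append]⟩

theorem isCycle_swap {u v : V} {p : G.Walk u v} {q : G.Walk v u} (h : (p.append q).IsCycle) :
    (q.append p).IsCycle := by
  classical
  rw [Walk.isCycle_def, Walk.isTrail_def] at h ⊢
  obtain ⟨h1, h2, h3⟩ := h
  refine ⟨?_, ?_, ?_⟩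
  · rw [Walk.edges_append] at h1 ⊢
    exact (List.perm_append_comm.nodup_iff).1 h1
  · intro h
    apply h2
    have h4 := congrArg Walk.length h
    apply Walk.Nil.eq_nil
    rw [← Walk.length_eq_zero_iff]
    rw [Walk.length_append, Walk.length_nil] at h4
    rw [Walk.length_append]
    omega
  · rw [← Walk.map_snd_darts, Walk.darts_append, List.map_append] at h3 ⊢
    exact (List.perm_append_comm.nodup_iff).1 h3

/-- An edge of a cycle at its base point is the first or the last one. -/
theorem IsCycle.edge_at_base {u : V} {K : G.Walk u u} (hK : K.IsCycle) {t : V}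
    (he : s(t, u) ∈ K.edges) :
    some s(t, u) = K.edges.head? ∨ some s(t, u) = K.edges.getLast? := by
  cases K with
  | nil => simp at he
  | @cons _ x _ h P =>
    rw [Walk.cons_isCycle_iff] at hK
    rw [Walk.edges_cons, List.mem_cons] at he
    rcases he with he | he
    · left; simp [he]
    · right
      have key : ∀ {a b : V} (P : G.Walk a b), P.IsPath → s(t, b) ∈ P.edges →
          some s(t, b) = P.edges.getLast? := by
        intro a b P
        induction P using Walk.concatRec with
        | Hnil => simp
        | @Hconcat a c b p h _ =>
          intro hp hb
          rw [Walk.edges_concat, List.concat_eq_append] at hb ⊢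
          rw [List.mem_append] at hb
          rcases hb with hb | hb
          · rw [Walk.concat_isPath_iff] at hp
            exact absurd (p.snd_mem_support_of_mem_edges hb) hp.2
          · rw [List.mem_singleton] at hb
            simp [hb]
      rw [key P hK.1 he, Walk.edges_cons]
      cases hP : P.edges with
      | nil => rw [hP] at he; simp at he
      | cons a l => simp

end Cycles

/-! ### The reduced form of a short closed walk that covers a cycle. -/

section Structure

variable {V : Type*} {G : SimpleGraph V}

open Classical in
/-- The indicator function of a set of darts, antisymmetrized. -/
noncomputable def dartIndicator (p : G.Dart → Prop) (e : G.Dart) : ℤ :=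
  (if p e then 1 else 0) - (if p e.symm then 1 else 0)

theorem dartIndicator_symm (p : G.Dart → Prop) (e : G.Dart) :
    dartIndicator p e.symm = - dartIndicator p e := by
  unfold dartIndicator
  rw [Dart.symm_symm]
  ring

theorem flow_dartIndicator (p : G.Dart → Prop) [DecidablePred p]
    [DecidablePred fun e : G.Dart => p e.symm] {u v : V} (W : G.Walk u v) :
    flow (dartIndicator p) W =
      (W.darts.countP (fun e => p e) : ℤ) - W.darts.countP (fun e => p e.symm) := by
  classical
  unfold flow
  induction W.darts with
  | nil => simp
  | cons a l ih =>
    rw [List.map_cons, List.sum_cons, ih, List.countP_cons, List.countP_cons]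
    push_cast
    simp only [decide_eq_true_eq, dartIndicator]
    split_ifs <;> ring

theorem flow_conj {f : G.Dart → ℤ} (hf : ∀ e, f e.symm = - f e) {z u : V} (q : G.Walk z u)
    (K : G.Walk u u) : flow f (q.append (K.append q.reverse)) = flow f K := by
  rw [flow_append, flow_append, flow_reverse hf]
  ring

/-- Edges of a closed walk that do not lie on its reduced cycle are used in both directions. -/
theorem two_le_count_of_notMem {z u : V} {W : G.Walk z z} {q : G.Walk z u} {K : G.Walk u u}
    (h : Reduct W (q.append (K.append q.reverse))) {e : Sym2 V} (heW : e ∈ W.edges)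
    (heK : e ∉ K.edges) [DecidableEq V] : 2 ≤ W.edges.count e := by
  classical
  obtain ⟨d, hd, rfl⟩ := List.mem_map.1 heW
  -- The indicator of a single dart measures its net traversals. Conjugation by `q` does not affect
  -- this number and it is 0 on `K`, so `W` uses `d` and `d.symm` equally often.
  have h1 := h.flow _ (dartIndicator_symm (fun e => e = d))
  rw [flow_conj (dartIndicator_symm _), flow_dartIndicator, flow_dartIndicator] at h1
  have hK : ∀ x ∈ K.darts, x ≠ d ∧ x.symm ≠ d := by
    intro x hx
    constructor
    · rintro rfl
      exact heK (List.mem_map_of_mem hx)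
    · rintro rfl
      apply heK
      rw [Dart.edge_symm]
      exact List.mem_map_of_mem hx
  have h2 : K.darts.countP (fun e => decide (e = d)) = 0 := by
    rw [List.countP_eq_zero]
    intro x hx
    simpa using (hK x hx).1
  have h3 : K.darts.countP (fun e => decide (e.symm = d)) = 0 := by
    rw [List.countP_eq_zero]
    intro x hx
    simpa using (hK x hx).2
  rw [h2, h3] at h1
  have h4 : 0 < W.darts.countP (fun e => decide (e = d)) :=
    List.countP_pos_iff.2 ⟨d, hd, by simp⟩
  have h5 : 0 < W.darts.countP (fun e => decide (e.symm = d)) := by omega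
  obtain ⟨x, hx, hxd⟩ := List.countP_pos_iff.1 h5
  have hxd : x = d.symm := by
    rw [decide_eq_true_eq] at hxd
    rw [← hxd, Dart.symm_symm]
  subst hxd
  have h6 : [d, d.symm].Subperm W.darts := by
    refine List.subperm_of_subset ?_ ?_
    · simp [(Dart.symm_ne d).symm]
    · intro y hy
      simp only [List.mem_cons, List.not_mem_nil, or_false] at hy
      rcases hy with rfl | rfl
      · exact hd
      · exact hx
  obtain ⟨l, hl, hs⟩ := h6
  have h7 := (hs.map Dart.edge).count_le d.edge
  rw [(hl.map Dart.edge).count_eq] at h7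
  simpa [Walk.edges] using h7

/-- A closed walk of length less than `2 g` that covers a cycle and goes around it in its direction
reduces to a conjugate of that cycle. -/
theorem CyclesGE.reduct_structure {g : ℕ} (hg : CyclesGE G g) {v z : V} {C : G.Walk v v}
    (hC : C.IsCycle) {W W' : G.Walk z z} (hlt : W.length < 2 * g) (hCW : C.edges ⊆ W.edges)
    (hdir : SameDirection C W) (hred : Reduct W W') :
    ∃ (u : V) (q : G.Walk z u) (K : G.Walk u u), W' = q.append (K.append q.reverse) ∧
      CyclicNB K ∧ K.IsCycle ∧ K.length = C.length ∧ (∀ e, e ∈ C.edges ↔ e ∈ K.edges) ∧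
      ∀ hu : u = v, K.copy hu hu = C := by
  classical
  obtain ⟨u, q, K, rfl, hK⟩ := exists_cyclic_decomposition W' hred.nb
  have hflow : 0 < flow (dartIndicator (fun e => e ∈ C.darts)) K := by
    rw [← flow_conj (dartIndicator_symm _) q K, hred.flow _ (dartIndicator_symm _),
      flow_dartIndicator]
    unfold SameDirection at hdir
    rw [sub_pos, Nat.cast_lt]
    convert! hdir
  have hshare : ∃ e ∈ K.darts, e ∈ C.darts := by
    by_contra hno
    push Not at hno
    refine absurd hflow (not_lt.2 ?_)
    rw [flow_dartIndicator, List.countP_eq_zero.2 (by simpa using hno)]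
    simp
  obtain ⟨e, heK, heC⟩ := hshare
  have hKlen : K.length ≤ W.length := by
    have := hred.length_le
    simp at this
    omega
  have hKcyc : K.IsCycle := by
    refine hg.isCycle_of_cyclicNB hK ?_ (by omega)
    intro h0
    rw [← Walk.length_darts, List.length_eq_zero_iff] at h0
    rw [h0] at heK
    simp at heK
  -- Both cycles are opened at the shared dart. They become paths with the same ends, and equality
  -- of these paths also fixes the orientation.
  obtain ⟨C₁, C₂, hCs⟩ := exists_split_at_dart heC
  obtain ⟨K₁, K₂, hKs⟩ := exists_split_at_dart heK
  have hPC : (C₂.append C₁).IsPath := by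
    have := isCycle_swap (hCs ▸ hC)
    rw [Walk.cons_append, Walk.cons_isCycle_iff] at this
    exact this.1
  have hPK : (K₂.append K₁).IsPath := by
    have := isCycle_swap (hKs ▸ hKcyc)
    rw [Walk.cons_append, Walk.cons_isCycle_iff] at this
    exact this.1
  have hCe : ∀ x, x ∈ C.edges ↔ x = e.edge ∨ x ∈ (C₂.append C₁).edges := by
    intro x
    rw [hCs]
    simp only [Walk.edges_append, Walk.edges_cons, List.mem_append, List.mem_cons]
    rw [show s(e.fst, e.snd) = e.edge from rfl]
    tauto
  have hKe : ∀ x, x ∈ K.edges ↔ x = e.edge ∨ x ∈ (K₂.append K₁).edges := by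
    intro x
    rw [hKs]
    simp only [Walk.edges_append, Walk.edges_cons, List.mem_append, List.mem_cons]
    rw [show s(e.fst, e.snd) = e.edge from rfl]
    tauto
  have hsub : ∀ x ∈ (C₂.append C₁).edges, x ∈ K.edges := by
    by_contra hno
    push Not at hno
    obtain ⟨a, b, P₁, α, P₂, hP, ha, hb, hα0, hα⟩ := exists_arc K (C₂.append C₁)
      (K.dart_snd_mem_support_of_mem_darts heK) (K.dart_fst_mem_support_of_mem_darts heK) hno
    have hαp : α.IsPath := by
      rw [hP] at hPC
      exact hPC.of_append_right.of_append_left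
    have hαne : α.edges ≠ [] := by
      intro h
      apply hα0
      rw [← Walk.length_edges, h, List.length_nil]
    obtain ⟨e₁, he₁⟩ := List.exists_mem_of_ne_nil _ hαne
    have h2g := hg.two_mul_le_of_arc_disjoint hKcyc ha hb hαp ⟨e₁, he₁, hα e₁ he₁⟩
    -- `W` covers each edge of `α` at least twice and each edge of `K` at least once, so `2 *
    -- α.length + K.length ≤ W.length < 2 * g`, against `h2g`.
    have hsp : (α.edges ++ α.edges ++ K.edges).Subperm W.edges := by
      rw [List.subperm_ext_iff]
      intro x hx
      rw [List.count_append, List.count_append]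
      by_cases hxK : x ∈ K.edges
      · have h1 : α.edges.count x = 0 := List.count_eq_zero.2 fun h => hα x h hxK
        have h2 : K.edges.count x = 1 := List.count_eq_one_of_mem hKcyc.edges_nodup hxK
        have h3 : x ∈ W.edges := by
          apply hred.edges.subset
          simp [hxK]
        have := List.count_pos_iff.2 h3
        omega
      · have hxα : x ∈ α.edges := by
          simp only [List.mem_append, or_self, hxK, or_false] at hx
          exact hx
        have h1 : α.edges.count x = 1 := List.count_eq_one_of_mem hαp.isTrail.edges_nodup hxα
        have h2 : K.edges.count x = 0 := List.count_eq_zero.2 hxK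
        have h3 : x ∈ C.edges := by
          rw [hCe, hP]
          right
          simp [hxα]
        have := two_le_count_of_notMem hred (hCW h3) hxK
        omega
    have := hsp.length_le
    simp at this
    omega
  have hnot : e.edge ∉ (C₂.append C₁).edges := by
    have := isCycle_swap (hCs ▸ hC)
    rw [Walk.cons_append, Walk.cons_isCycle_iff] at this
    exact this.2
  have heq : C₂.append C₁ = K₂.append K₁ := by
    refine path_eq_of_edges_subset hPC hPK fun x hx => ?_
    rcases (hKe x).1 (hsub x hx) with rfl | h
    · exact absurd hx hnot
    · exact h
  refine ⟨u, q, K, rfl, hK, hKcyc, ?_, ?_, ?_⟩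
  · have := congrArg Walk.length heq
    rw [hCs, hKs]
    simp at this ⊢
    omega
  · intro x
    rw [hCe, hKe, heq]
  · rintro rfl
    obtain ⟨h1, h2⟩ := IsPath.append_unique hPC heq
    rw [Walk.copy_rfl_rfl, hCs, hKs, h1, h2]

end Structure

/-! ### Walks starting off the cycle reduce to the reference walk. -/

section Outer

variable {V : Type*} {G : SimpleGraph V}

theorem exists_append_of_le_length {u v : V} (W : G.Walk u v) {n : ℕ} (hn : n ≤ W.length) :
    ∃ (x : V) (a : G.Walk u x) (b : G.Walk x v), W = a.append b ∧ a.length = n := by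
  induction W generalizing n with
  | nil => exact ⟨_, Walk.nil, Walk.nil, rfl, (Nat.le_zero.1 hn).symm⟩
  | cons h p ih =>
    cases n with
    | zero => exact ⟨_, Walk.nil, Walk.cons h p, rfl, rfl⟩
    | succ n =>
      obtain ⟨x, a, b, rfl, rfl⟩ := ih (Nat.le_of_succ_le_succ hn)
      exact ⟨x, Walk.cons h a, b, rfl, rfl⟩

theorem getVert_append_left {u v w : V} (p : G.Walk u v) (q : G.Walk v w) {m : ℕ}
    (hm : m ≤ p.length) : (p.append q).getVert m = p.getVert m := by
  rw [Walk.getVert_append]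
  split_ifs with h
  · rfl
  · obtain rfl : m = p.length := by omega
    simp

theorem getVert_append_add {u v w : V} (p : G.Walk u v) (q : G.Walk v w) (m : ℕ) :
    (p.append q).getVert (p.length + m) = q.getVert m := by
  rw [Walk.getVert_append]
  simp

theorem exists_getVert_eq_fst {u v : V} {W : G.Walk u v} {d : G.Dart} (hd : d ∈ W.darts) :
    ∃ m < W.length, W.getVert m = d.fst := by
  obtain ⟨W₁, W₂, rfl⟩ := exists_split_at_dart hd
  refine ⟨W₁.length, by simp, ?_⟩
  simpa using getVert_append_add W₁ (Walk.cons d.adj W₂) 0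

theorem exists_prefix_of_firstVertexOn {v z x : V} {C : G.Walk v v} {W : G.Walk z z}
    (h : FirstVertexOn C W x) :
    x ∈ C.support ∧ ∃ (a : G.Walk z x) (b : G.Walk x z), W = a.append b ∧
      ∀ d ∈ a.darts, d.fst ∉ C.support := by
  obtain ⟨hx, n, hn, hnx, hlt⟩ := h
  obtain ⟨y, a, b, rfl, rfl⟩ := exists_append_of_le_length W hn
  have : y = x := by
    rw [← hnx]
    simpa using (getVert_append_add a b 0).symm
  subst this
  refine ⟨hx, a, b, rfl, fun d hd => ?_⟩
  obtain ⟨m, hm, hmd⟩ := exists_getVert_eq_fst hd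
  rw [← hmd, ← getVert_append_left a b hm.le]
  exact hlt m hm

/-- The walks counted by `outerWalks` reduce to the reference walk, and the path to the cycle meets
the cycle only at its end. -/
theorem CyclesGE.reduct_eq_referenceWalk {g : ℕ} (hg : CyclesGE G g) {v z : V} {C : G.Walk v v}
    (hC : C.IsCycle) {k : ℕ} (hik : C.length + 2 * k < 2 * g) {p : G.Walk z v} (hp : p.IsPath)
    (hpk : p.length ≤ k) {W : G.Walk z z} (hlen : W.length = C.length + 2 * k)
    (hW : IsDirectedWalkWithCycle C W) (hfirst : FirstVertexOn C W v) :
    Reduct W (referenceWalk C p) ∧ ∀ d ∈ p.darts, d.fst ∉ C.support := by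
  have hgC := hg C hC
  obtain ⟨-, a, b, hab, ha⟩ := exists_prefix_of_firstVertexOn hfirst
  obtain ⟨a', ha'⟩ := exists_reduct a
  obtain ⟨b', hb'⟩ := exists_reduct b
  -- `W` is cut at its first visit to the cycle and both parts are reduced separately; `f` is what
  -- still cancels at the junction. The aim is to show that `f` is trivial and that `e` is `p`.
  obtain ⟨y, e, f, r, hae, hbf, her⟩ := exists_cancel a' b' ha'.nb hb'.nb
  have ha'd : ∀ d ∈ a'.darts, d.fst ∉ C.support := fun d hd => ha d (ha'.darts.subset hd)
  have hred : Reduct W (e.append r) := by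
    refine ⟨her, ?_, ?_⟩
    · rw [hab, Walk.darts_append, Walk.darts_append]
      refine List.Sublist.append (List.Sublist.trans ?_ ha'.darts)
        (List.Sublist.trans ?_ hb'.darts)
      · rw [hae]; simp
      · rw [hbf]; simp
    · intro F hF
      rw [hab, flow_append, flow_append, ← ha'.flow F hF, ← hb'.flow F hF, hae, hbf, flow_append,
        flow_append, flow_reverse hF]
      ring
  have hlen' : e.length + 2 * f.length + r.length ≤ C.length + 2 * k := by
    have h1 := ha'.length_le
    have h2 := hb'.length_le
    have h3 := congrArg Walk.length hab
    rw [hae] at h1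
    rw [hbf] at h2
    simp at h1 h2 h3
    omega
  obtain ⟨u, q, K, heq, hKnb, hK, hKlen, hKe, hKC⟩ := hg.reduct_structure hC (by omega)
    hW.edges_subset hW.sameDirection hred
  have hsupp : ∀ x, x ∈ C.support ↔ x ∈ K.support := by
    have key : ∀ {a b : V} {C : G.Walk a a} {K : G.Walk b b}, C.IsCycle →
        (∀ e, e ∈ C.edges → e ∈ K.edges) → ∀ x ∈ C.support, x ∈ K.support := by
      intro a b C K hC hCK x hx
      rw [Walk.mem_support_iff_exists_mem_edges_of_not_nil hC.not_nil] at hx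
      obtain ⟨e, he, hxe⟩ := hx
      exact Walk.mem_support_of_mem_edges (hCK e he) hxe
    exact fun x => ⟨key hC (fun e => (hKe e).1) x, key hK (fun e => (hKe e).2) x⟩
  have huC : u ∈ C.support := (hsupp u).2 K.start_mem_support
  -- If `e` went properly beyond `q`, it would leave the vertex `u` of the cycle, but `a'` meets the
  -- cycle only at its end.
  obtain ⟨m, hqm, hrm⟩ : ∃ m : G.Walk y u, q = e.append m ∧ r = m.append (K.append q.reverse) := by
    rcases append_eq_append_cases heq with ⟨m, h1, h2⟩ | ⟨m, h1, h2⟩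
    · cases m with
      | nil => exact ⟨Walk.nil, by simpa using h1.symm, by simpa using h2.symm⟩
      | cons h m =>
        refine absurd huC (ha'd ⟨(u, _), h⟩ ?_)
        rw [hae, h1]
        simp
    · exact ⟨m, h1, h2⟩
  have hqf : q.length + f.length ≤ k := by
    rw [hrm] at hlen'
    have := congrArg Walk.length hqm
    simp at hlen' this
    omega
  have hqnb : NB q := (heq ▸ her).append_left
  -- The only edges of `K` at `u` are its first and its last one, and either would create a
  -- backtrack where `q` or its reverse meets `K`.
  have hnotend : ∀ ε ∈ q.edges.getLast?, ε ∉ K.edges := by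
    intro ε hε hεK
    obtain ⟨t, rfl⟩ : ∃ t, ε = s(t, u) := by
      clear hqnb hqf hqm heq hrm
      induction q using Walk.concatRec with
      | Hnil => simp at hε
      | @Hconcat _ t u q h _ =>
        simp only [Walk.edges_concat, List.concat_eq_append, List.getLast?_append,
          List.getLast?_singleton, Option.some_or, Option.mem_def, Option.some.injEq] at hε
        exact ⟨t, hε.symm⟩
    have hall := heq ▸ her
    have hKq := nb_append_iff.1 hall.append_right
    have hqK := nb_append_iff.1 (by rw [Walk.append_assoc] at hall; exact hall.append_left)
    rcases IsCycle.edge_at_base hK hεK with h | h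
    · exact hqK.2.2 _ hε _ h.symm rfl
    · refine hKq.2.2 _ h.symm _ ?_ rfl
      rw [Walk.edges_reverse, List.head?_reverse]
      exact hε
  have hvC : v ∈ K.support := (hsupp v).1 C.start_mem_support
  have huK : u ∈ K.support := K.start_mem_support
  have hf0 : f.length = 0 := by
    by_contra hf0
    -- This prefix of `b'` joins two vertices of `K`, has length at most `k`, and leaves `K` along
    -- `f`; the arc bound would give `2 * g ≤ 2 * k + C.length`.
    have hα : NB (f.reverse.append m) := by
      have := hb'.nb
      rw [hbf, hrm, Walk.append_assoc] at this
      exact this.append_left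
    have hαp := hg.isPath_of_nb hα (by
      have := congrArg Walk.length hqm
      simp at this ⊢
      omega)
    have := hg.two_mul_le_of_arc_disjoint hK hvC huK hαp (by
      obtain ⟨d, hd⟩ := List.exists_mem_of_ne_nil f.darts (by
        intro h
        rw [← Walk.length_darts, h] at hf0
        simp at hf0)
      refine ⟨d.edge, ?_, fun hmem => ?_⟩
      · have : d.edge ∈ f.edges := List.mem_map_of_mem hd
        simp [this]
      · refine ha'd d (by rw [hae]; simp [hd]) ((hsupp _).2 ?_)
        exact K.fst_mem_support_of_mem_edges hmem)
    have := congrArg Walk.length hqm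
    simp at this
    rw [Walk.length_append, Walk.length_reverse] at *
    omega
  cases f with
  | cons => simp at hf0
  | nil =>
    -- With `f` trivial, `m` joins `v` to `u` on `K`, and its last edge is off `K` by `hnotend`; the
    -- arc bound excludes this as well.
    have hm0 : m.length = 0 := by
      by_contra hm0
      have hmnb : NB m := (hqm ▸ hqnb).append_right
      have hle := congrArg Walk.length hqm
      rw [Walk.length_append] at hle
      have hmp := hg.isPath_of_nb hmnb (by omega)
      have hne : m.edges ≠ [] := by
        intro h
        rw [← Walk.length_edges, h] at hm0
        simp at hm0
      have := hg.two_mul_le_of_arc_disjoint hK hvC huK hmp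
        ⟨m.edges.getLast hne, List.getLast_mem hne, hnotend _ (by
          rw [hqm, Walk.edges_append, List.getLast?_append, List.getLast?_eq_getLast_of_ne_nil hne]
          simp)⟩
      omega
    cases m with
    | cons => simp at hm0
    | nil =>
      have hKC' := hKC rfl
      rw [Walk.copy_rfl_rfl] at hKC'
      subst hKC'
      rw [Walk.append_nil] at hae hqm
      have hqp : q = p := by
        refine hg.path_eq (hg.isPath_of_nb hqnb (by omega)) hp (by omega)
      subst hqp
      refine ⟨?_, ?_⟩
      · rw [heq] at hred
        exact hred
      · rw [hqm, ← hae]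
        exact ha'd

end Outer

/-! ### Decomposition of a walk into first passage blocks. -/

section Blocks

variable {V : Type*} {G : SimpleGraph V}

/-- The walks of length `n` from `u` to `w` that reach `w` only at the end. -/
def firstPassage (G : SimpleGraph V) (u w : V) (n : ℕ) : Set (G.Walk u w) :=
  {A | A.length = n ∧ ∀ m < A.length, A.getVert m ≠ w}

/-- The walks that decompose into blocks of lengths `2 s_j + 1` along `R`, followed by a closed walk
of length `2 s_N`, where `N` is the length of `R`. -/
def blockWalks : {u v : V} → G.Walk u v → (ℕ → ℕ) → Set (G.Walk u v)
  | _, _, Walk.nil, s => {W | W.length = 2 * s 0}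
  | u, _, Walk.cons (v := w) _ R, s => {W | ∃ A ∈ firstPassage G u w (2 * s 0 + 1),
      ∃ B ∈ blockWalks R (fun j => s (j + 1)), W = A.append B}

theorem mem_blockWalks_cons {u w v : V} {h : G.Adj u w} {R : G.Walk w v} {s : ℕ → ℕ}
    {W : G.Walk u v} : W ∈ blockWalks (Walk.cons h R) s ↔
      ∃ A ∈ firstPassage G u w (2 * s 0 + 1), ∃ B ∈ blockWalks R (fun j => s (j + 1)),
        W = A.append B := Iff.rfl

theorem length_of_mem_blockWalks {u v : V} {R W : G.Walk u v} {s : ℕ → ℕ}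
    (h : W ∈ blockWalks R s) :
    W.length = R.length + 2 * ∑ j ∈ Finset.range (R.length + 1), s j := by
  induction R generalizing s with
  | nil =>
    have : W.length = 2 * s 0 := h
    simp [this]
  | cons h' R ih =>
    obtain ⟨A, hA, B, hB, rfl⟩ := mem_blockWalks_cons.1 h
    rw [Walk.length_append, ih hB, hA.1, Walk.length_cons, Finset.sum_range_succ' _ (R.length + 1)]
    ring

theorem firstPassage_unique {u w v : V} {n n' : ℕ} {A A' : G.Walk u w} {B B' : G.Walk w v}
    (hA : A ∈ firstPassage G u w n) (hA' : A' ∈ firstPassage G u w n')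
    (h : A.append B = A'.append B') : A = A' ∧ B = B' := by
  rcases append_eq_append_cases h with ⟨m, rfl, rfl⟩ | ⟨m, rfl, rfl⟩
  · cases m with
    | nil => simp
    | cons h' m =>
      refine absurd ?_ (hA.2 A'.length (by simp))
      simpa using getVert_append_add A' (Walk.cons h' m) 0
  · cases m with
    | nil => simp
    | cons h' m =>
      refine absurd ?_ (hA'.2 A.length (by simp))
      simpa using getVert_append_add A (Walk.cons h' m) 0

theorem blockWalks_unique {u v : V} {R W : G.Walk u v} {s s' : ℕ → ℕ}
    (h : W ∈ blockWalks R s) (h' : W ∈ blockWalks R s') : ∀ j ≤ R.length, s j = s' j := by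
  induction R generalizing s s' with
  | nil =>
    intro j hj
    have h1 : W.length = 2 * s 0 := h
    have h2 : W.length = 2 * s' 0 := h'
    obtain rfl : j = 0 := by simpa using hj
    omega
  | cons hadj R ih =>
    obtain ⟨A, hA, B, hB, rfl⟩ := mem_blockWalks_cons.1 h
    obtain ⟨A', hA', B', hB', heq⟩ := mem_blockWalks_cons.1 h'
    obtain ⟨rfl, rfl⟩ := firstPassage_unique hA hA' heq
    intro j hj
    cases j with
    | zero =>
      have := hA.1
      have := hA'.1
      omega
    | succ j => exact ih hB hB' j (by simpa using hj)

theorem blockWalks_congr {u v : V} {R W : G.Walk u v} {s s' : ℕ → ℕ}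
    (hs : ∀ j ≤ R.length, s j = s' j) (h : W ∈ blockWalks R s) : W ∈ blockWalks R s' := by
  induction R generalizing s s' with
  | nil =>
    have h1 : W.length = 2 * s 0 := h
    rw [hs 0 le_rfl] at h1
    exact h1
  | cons hadj R ih =>
    obtain ⟨A, hA, B, hB, rfl⟩ := mem_blockWalks_cons.1 h
    rw [hs 0 (Nat.zero_le _)] at hA
    exact ⟨A, hA, B, ih (fun j hj => hs (j + 1) (by simpa using hj)) hB, rfl⟩

/-- Greedy choice loses nothing: whatever follows some occurrence of `w` also follows its earliest
one, the end of `A`. -/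
theorem sublist_of_cons_sublist_append {u w : V} {A : G.Walk u w} {l b : List V}
    (hA : ∀ m < A.length, A.getVert m ≠ w) (h : (w :: l).Sublist (A.support ++ b)) :
    l.Sublist b := by
  induction A with
  | nil => simpa using h
  | @cons u x w hadj p ih =>
    rw [Walk.support_cons, List.cons_append] at h
    cases h with
    | cons _ h =>
      refine ih (fun m hm => ?_) h
      simpa using hA (m + 1) (by simpa using hm)
    | cons_cons _ _ => exact absurd rfl (hA 0 (by simp))

theorem exists_mem_blockWalks (hpar : ∀ (x : V) (W : G.Walk x x), Even W.length) {u v : V}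
    {R W : G.Walk u v} (h : R.support.tail.Sublist W.support.tail) :
    ∃ s, W ∈ blockWalks R s := by
  classical
  induction R with
  | nil =>
    obtain ⟨n, hn⟩ := hpar _ W
    exact ⟨fun _ => n, hn.trans (two_mul n).symm⟩
  | @cons u w v hadj R ih =>
    rw [Walk.support_cons, List.tail_cons, ← Walk.cons_tail_support] at h
    have hw : w ∈ W.support := List.mem_of_mem_tail (h.subset (List.mem_cons_self))
    set A := W.takeUntil w hw with hA
    set B := W.dropUntil w hw with hB
    have hAB : A.append B = W := W.take_spec hw
    have hfp : ∀ m < A.length, A.getVert m ≠ w := by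
      intro m hm
      rw [hA, Walk.getVert_takeUntil hw hm.le]
      exact W.getVert_lt_length_takeUntil_ne hw hm
    -- Closing `A` up with the edge `uw` gives a closed walk, which is even.
    have hodd : ∃ n, A.length = 2 * n + 1 := by
      have := hpar _ (Walk.cons hadj.symm A)
      rw [Walk.length_cons, Nat.even_add_one, Nat.not_even_iff_odd] at this
      exact this
    obtain ⟨n, hn⟩ := hodd
    have hsub : R.support.tail.Sublist B.support.tail := by
      refine sublist_of_cons_sublist_append hfp (h.trans ?_)
      rw [← Walk.support_append, hAB]
      exact List.tail_sublist _
    obtain ⟨s, hs⟩ := ih hsub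
    refine ⟨fun j => Nat.casesOn j n s, mem_blockWalks_cons.2 ⟨A, ⟨hn, hfp⟩, B, hs, hAB.symm⟩⟩

theorem sum_blocks_succ (s : ℕ → ℕ) (j : ℕ) :
    ∑ i ∈ Finset.range (j + 1), (2 * s i + 1) =
      (2 * s 0 + 1) + ∑ i ∈ Finset.range j, (2 * s (i + 1) + 1) := by
  rw [Finset.sum_range_succ', add_comm]

/-- Links the recursive form, suited to induction, with the marks: mark `j` sits at the sum of the
first `j` block lengths. -/
theorem mem_blockWalks_iff {u v : V} {R W : G.Walk u v} {s : ℕ → ℕ} :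
    W ∈ blockWalks R s ↔
      (∀ j < R.length,
        W.getVert (∑ i ∈ Finset.range (j + 1), (2 * s i + 1)) = R.getVert (j + 1) ∧
        ∀ m, ∑ i ∈ Finset.range j, (2 * s i + 1) < m →
          m < ∑ i ∈ Finset.range (j + 1), (2 * s i + 1) → W.getVert m ≠ R.getVert (j + 1)) ∧
      W.length = ∑ i ∈ Finset.range R.length, (2 * s i + 1) + 2 * s R.length := by
  induction R generalizing s with
  | nil => simp [blockWalks]
  | @cons u w v hadj R ih =>
    rw [mem_blockWalks_cons]
    constructor
    · rintro ⟨A, hA, B, hB, rfl⟩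
      obtain ⟨h1, h2⟩ := ih.1 hB
      refine ⟨fun j hj => ?_, ?_⟩
      · cases j with
        | zero =>
          refine ⟨?_, fun m hm1 hm2 => ?_⟩
          · simpa [hA.1] using getVert_append_add A B 0
          · have hm : m < A.length := by simpa [hA.1] using hm2
            rw [getVert_append_left A B hm.le]
            simpa using hA.2 m hm
        | succ j =>
          obtain ⟨h3, h4⟩ := h1 j (by simpa using hj)
          refine ⟨?_, fun m hm1 hm2 => ?_⟩
          · rw [sum_blocks_succ, ← hA.1, getVert_append_add, h3]
            simp
          · rw [sum_blocks_succ, ← hA.1] at hm1 hm2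
            obtain ⟨t, rfl⟩ := Nat.exists_eq_add_of_le (le_self_add.trans hm1.le)
            rw [getVert_append_add]
            simpa using h4 t (by omega) (by omega)
      · rw [Walk.length_append, h2, hA.1, Walk.length_cons, sum_blocks_succ]
        ring
    · rintro ⟨h1, h2⟩
      have h0 := h1 0 (by simp)
      have hle : 2 * s 0 + 1 ≤ W.length := by
        rw [h2, Walk.length_cons, sum_blocks_succ]
        omega
      obtain ⟨x, A, B, rfl, hA⟩ := exists_append_of_le_length W hle
      have hx : x = w := by
        have h3 := h0.1
        rw [Finset.sum_range_one, ← hA] at h3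
        have h4 := getVert_append_add A B 0
        simp only [add_zero, Walk.getVert_zero] at h4
        rw [← h4, h3]
        simp
      subst hx
      refine ⟨A, ⟨hA, fun m hm => ?_⟩, B, ih.2 ⟨fun j hj => ?_, ?_⟩, rfl⟩
      -- The marks restrict only positions strictly after the previous mark, whereas `firstPassage`
      -- includes position 0; there the walk is at `u`, which differs from its neighbour `w`.
      · rcases Nat.eq_zero_or_pos m with rfl | hpos
        · simpa using hadj.ne
        · have := h0.2 m (by simpa using hpos) (by rw [Finset.sum_range_one, ← hA]; exact hm)
          rw [getVert_append_left A B hm.le] at this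
          simpa using this
      · obtain ⟨h3, h4⟩ := h1 (j + 1) (by simpa using hj)
        rw [sum_blocks_succ, ← hA, getVert_append_add] at h3
        refine ⟨by simpa using h3, fun m hm1 hm2 => ?_⟩
        have := h4 (A.length + m) (by rw [sum_blocks_succ, ← hA]; omega)
          (by rw [sum_blocks_succ, ← hA]; omega)
        rw [getVert_append_add] at this
        simpa using this
      · rw [Walk.length_append, hA, Walk.length_cons, sum_blocks_succ] at h2
        omega

/-- Extension of a finite sequence by zeros. -/
def extendZero {n : ℕ} (s : Fin n → ℕ) (j : ℕ) : ℕ := if h : j < n then s ⟨j, h⟩ else 0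

theorem extendZero_of_lt {n : ℕ} (s : Fin n → ℕ) {j : ℕ} (h : j < n) :
    extendZero s j = s ⟨j, h⟩ := dif_pos h

theorem sum_extendZero {n : ℕ} (s : Fin n → ℕ) :
    ∑ j ∈ Finset.range n, extendZero s j = ∑ j, s j := by
  rw [Finset.sum_range]
  exact Finset.sum_congr rfl fun j _ => extendZero_of_lt s j.2

theorem hasBlocks_iff {z : V} {R W : G.Walk z z} {N : ℕ} (hN : R.length = N)
    (s : Fin (N + 1) → ℕ) : HasBlocks R W s ↔ W ∈ blockWalks R (extendZero s) := by
  subst hN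
  rw [mem_blockWalks_iff]
  constructor
  · rintro ⟨τ, hτ, hstep, hlast⟩
    have hτs : ∀ j (hj : j < R.length + 1),
        τ ⟨j, hj⟩ = ∑ i ∈ Finset.range j, (2 * extendZero s i + 1) := by
      intro j
      induction j with
      | zero => intro _; simpa using hτ.zero
      | succ j ih =>
        intro hj
        have h1 := hstep ⟨j, by omega⟩
        simp only [Fin.succ_mk, Fin.castSucc_mk] at h1
        rw [h1, Finset.sum_range_succ, ih, extendZero_of_lt s (by omega : j < R.length + 1)]
    refine ⟨fun j hj => ⟨?_, fun m hm1 hm2 => ?_⟩, ?_⟩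
    · have := hτ.getVert ⟨j, hj⟩
      simp only [Fin.succ_mk] at this
      rw [← this, hτs]
    · refine hτ.first ⟨j, hj⟩ m ?_ ?_
      · simp only [Fin.castSucc_mk]
        rwa [hτs]
      · simp only [Fin.succ_mk]
        rwa [hτs]
    · rw [hlast, extendZero_of_lt s (Nat.lt_succ_self _), ← hτs _ (Nat.lt_succ_self _)]
      rfl
  · rintro ⟨h1, h2⟩
    refine ⟨fun j => ∑ i ∈ Finset.range j, (2 * extendZero s i + 1), ⟨?_, ?_, ?_, ?_, ?_⟩, ?_, ?_⟩
    · simp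
    · intro j
      simp [Finset.sum_range_succ]
    · intro j
      rw [h2]
      refine le_add_right (Finset.sum_le_sum_of_subset ?_)
      exact Finset.range_subset_range.2 (Nat.lt_succ_iff.1 j.2)
    · intro j
      simpa using (h1 j j.2).1
    · intro j m hm1 hm2
      exact (h1 j j.2).2 m (by simpa using hm1) (by simpa using hm2)
    · intro j
      simp only [Fin.val_succ, Fin.val_castSucc]
      rw [Finset.sum_range_succ, extendZero_of_lt s (by omega : (j : ℕ) < R.length + 1)]
      rfl
    · rw [h2, extendZero_of_lt s (Nat.lt_succ_self _)]
      rfl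

end Blocks

/-! ### Short blocks, and the converse inclusion. -/

section ShortBlocks

variable {V : Type*} {G : SimpleGraph V}

theorem mem_support_iff_exists_getVert_le {u v x : V} {W : G.Walk u v} :
    x ∈ W.support ↔ ∃ m ≤ W.length, W.getVert m = x := by
  rw [Walk.mem_support_iff_exists_getVert]
  exact ⟨fun ⟨m, h1, h2⟩ => ⟨m, h2, h1⟩, fun ⟨m, h1, h2⟩ => ⟨m, h2, h1⟩⟩

/-- A short first passage walk to a neighbour is a closed walk followed by one step. -/
theorem CyclesGE.firstPassage_eq {g : ℕ} (hg : CyclesGE G g) {u w : V} (h : G.Adj u w) {s : ℕ}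
    (hs : 2 * s + 2 < g) {A : G.Walk u w} (hA : A ∈ firstPassage G u w (2 * s + 1)) :
    ∃ A₀ : G.Walk u u, A = A₀.append (Walk.cons h Walk.nil) ∧ A₀.length = 2 * s ∧
      w ∉ A₀.support := by
  classical
  induction A using Walk.concatRec with
  | Hnil => exact absurd rfl h.ne
  | @Hconcat u t w A₀ h' _ =>
    have hlen : A₀.length = 2 * s := by simpa using hA.1
    have hw : w ∉ A₀.support := by
      intro hw
      obtain ⟨m, hm, hmw⟩ := mem_support_iff_exists_getVert_le.1 hw
      refine hA.2 m (by simp; omega) ?_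
      rw [Walk.concat_eq_append, getVert_append_left _ _ hm, hmw]
    -- The shortened walk and the edge `uw` are paths of total length at most `2 * s + 2`, so they
    -- agree and the last step starts at `u`.
    have hut : (Walk.cons h Walk.nil : G.Walk u w) = A₀.bypass.concat h' := by
      refine hg.path_eq ?_ ?_ ?_
      · simp [h.ne]
      · rw [Walk.concat_isPath_iff]
        exact ⟨A₀.bypass_isPath, fun hw' => hw (A₀.support_bypass_subset_support hw')⟩
      · have := A₀.length_bypass_le_length
        simp
        omega
    have ht : t = u := by
      have := congrArg Walk.penultimate hut
      simpa using this.symm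
    subst ht
    exact ⟨A₀, by rw [Walk.concat_eq_append], hlen, hw⟩

theorem append_mem_firstPassage {u w : V} (h : G.Adj u w) {s : ℕ} {A₀ : G.Walk u u}
    (hlen : A₀.length = 2 * s) (hw : w ∉ A₀.support) :
    A₀.append (Walk.cons h Walk.nil) ∈ firstPassage G u w (2 * s + 1) := by
  refine ⟨by simp [hlen], fun m hm => ?_⟩
  have hm' : m ≤ A₀.length := by
    simp at hm
    omega
  rw [getVert_append_left _ _ hm']
  rintro rfl
  exact hw (A₀.getVert_mem_support m)

/-- Each block is a closed walk shorter than `g`, which carries no flow, followed by the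
corresponding dart of `R`. -/
theorem CyclesGE.blockWalks_flow_darts {g : ℕ} (hg : CyclesGE G g) {u v : V} {R W : G.Walk u v}
    {s : ℕ → ℕ} (hs : ∀ j ≤ R.length, 2 * s j + 2 < g) (hW : W ∈ blockWalks R s) :
    R.darts.Sublist W.darts ∧
      ∀ f : G.Dart → ℤ, (∀ e, f e.symm = - f e) → flow f W = flow f R := by
  induction R generalizing s with
  | nil =>
    have h0 : W.length = 2 * s 0 := hW
    refine ⟨by simp, fun f hf => ?_⟩
    rw [hg.flow_eq_zero (by have := hs 0 (by simp); omega) hf]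
    rfl
  | @cons u w v h R ih =>
    obtain ⟨A, hA, B, hB, rfl⟩ := mem_blockWalks_cons.1 hW
    have hs0 := hs 0 (by simp)
    obtain ⟨A₀, rfl, hlen, hw⟩ := hg.firstPassage_eq h hs0 hA
    obtain ⟨h1, h2⟩ := ih (fun j hj => hs (j + 1) (by simpa using hj)) hB
    refine ⟨?_, fun f hf => ?_⟩
    · rw [Walk.darts_append, Walk.darts_append, Walk.darts_cons, Walk.darts_cons, Walk.darts_nil]
      rw [List.append_assoc]
      exact (h1.cons_cons _).trans (List.sublist_append_right _ _)
    · rw [flow_append, flow_append, h2 f hf, hg.flow_eq_zero (by omega) hf]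
      simp [flow]

/-- A vertex on a closed walk is reached by a path of at most half the length. -/
theorem exists_short_path {u y : V} (A : G.Walk u u) {s : ℕ} (hA : A.length = 2 * s)
    (hy : y ∈ A.support) : ∃ Q : G.Walk u y, Q.IsPath ∧ Q.length ≤ s ∧
      ∀ x ∈ Q.support, x ∈ A.support := by
  classical
  have hspec := congrArg Walk.length (A.take_spec hy)
  rw [Walk.length_append] at hspec
  by_cases h : (A.takeUntil y hy).length ≤ s
  · refine ⟨(A.takeUntil y hy).bypass, Walk.bypass_isPath _, (Walk.length_bypass_le_length _).trans h,
      fun x hx => ?_⟩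
    exact A.support_takeUntil_subset_support hy (Walk.support_bypass_subset_support _ hx)
  · refine ⟨(A.dropUntil y hy).reverse.bypass, Walk.bypass_isPath _,
      (Walk.length_bypass_le_length _).trans (by rw [Walk.length_reverse]; omega), fun x hx => ?_⟩
    have := Walk.support_bypass_subset_support _ hx
    rw [Walk.support_reverse, List.mem_reverse] at this
    exact A.support_dropUntil_subset_support hy this

/-- The detours made along `p` cannot touch the cycle. Otherwise the way from `y` back along `p` to
`u`, continued by a shortest half of the detour, would be a path of length at most `k` between
vertices of the cycle that leaves it. No backtrack occurs at `u` because the detour avoids `w`. -/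
theorem CyclesGE.blockWalks_prefix {g : ℕ} (hg : CyclesGE G g) {x : V} {C : G.Walk x x}
    (hC : C.IsCycle) {k t : ℕ} (hik : C.length + 2 * k < 2 * g) {z y v : V} {p : G.Walk z y}
    (hy : y ∈ C.support)
    (hp : p.IsPath) (hpC : ∀ d ∈ p.darts, d.fst ∉ C.support) (hpk : p.length + t ≤ k)
    {Q : G.Walk y v} {s : ℕ → ℕ} (hs : ∀ j, s j ≤ t) {W : G.Walk z v}
    (hW : W ∈ blockWalks (p.append Q) s) :
    ∃ (W₁ : G.Walk z y) (W₂ : G.Walk y v), W = W₁.append W₂ ∧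
      ∀ d ∈ W₁.darts, d.fst ∉ C.support := by
  have hgC := hg C hC
  induction p generalizing s with
  | nil => exact ⟨Walk.nil, W, rfl, by simp⟩
  | @cons u w y h p ih =>
    rw [Walk.cons_append] at hW
    obtain ⟨A, hA, B, hB, rfl⟩ := mem_blockWalks_cons.1 hW
    have hpk' := hpk
    rw [Walk.length_cons] at hpk'
    have hs0 := hs 0
    obtain ⟨W₁, W₂, rfl, hW₁⟩ := ih hy ((Walk.cons_isPath_iff _ _).1 hp).1
      (fun d hd => hpC d (by simp [hd])) (by omega) (fun j => hs (j + 1)) hB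
    obtain ⟨A₀, rfl, hlen, hw⟩ := hg.firstPassage_eq h (by omega) hA
    have hu : u ∉ C.support := hpC ⟨(u, w), h⟩ (by simp)
    have hA₀ : ∀ a ∈ A₀.support, a ∉ C.support := by
      intro a ha haC
      obtain ⟨T, hT, hTlen, hTs⟩ := exists_short_path A₀ hlen ha
      have hnb : NB ((Walk.cons h p).reverse.append T) := by
        rw [nb_append_iff]
        refine ⟨(IsPath.nb hp).reverse, IsPath.nb hT, ?_⟩
        rintro e he e' he' rfl
        rw [Walk.edges_reverse, List.getLast?_reverse, Walk.edges_cons, List.head?_cons,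
          Option.mem_some_iff] at he
        subst he
        exact hw (hTs _ (T.snd_mem_support_of_mem_edges (List.mem_of_mem_head? he')))
      have hlen2 : ((Walk.cons h p).reverse.append T).length ≤ k := by
        rw [Walk.length_append, Walk.length_reverse]
        omega
      have := hg.two_mul_le_of_arc_disjoint hC hy haC
        (hg.isPath_of_nb hnb (by omega))
        ⟨s(u, w), by simp, fun he => hu (C.fst_mem_support_of_mem_edges he)⟩
      omega
    refine ⟨(A₀.append (Walk.cons h Walk.nil)).append W₁, W₂, by rw [Walk.append_assoc], ?_⟩
    intro d hd
    rw [Walk.darts_append, Walk.darts_append, List.mem_append, List.mem_append] at hd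
    rcases hd with (hd | hd) | hd
    · exact hA₀ _ (A₀.dart_fst_mem_support_of_mem_darts hd)
    · simp only [Walk.darts_cons, Walk.darts_nil, List.mem_singleton] at hd
      subst hd
      exact hu
    · exact hW₁ d hd

theorem exists_dart_of_lt {u v : V} {W : G.Walk u v} {m : ℕ} (hm : m < W.length) :
    ∃ d ∈ W.darts, d.fst = W.getVert m := by
  have hm' : m < W.darts.length := by simpa using hm
  refine ⟨W.darts[m], List.getElem_mem hm', ?_⟩
  rw [Walk.darts_getElem_eq_getVert]

theorem sameDirection_of_flow {v z : V} {C : G.Walk v v} (hC : C.IsCycle) {W : G.Walk z z}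
    (h : flow (dartIndicator (fun e => e ∈ C.darts)) W =
      flow (dartIndicator (fun e => e ∈ C.darts)) C) : SameDirection C W := by
  classical
  rw [flow_dartIndicator, flow_dartIndicator] at h
  have h1 : C.darts.countP (fun e => decide (e ∈ C.darts)) = C.darts.length := by
    rw [List.countP_eq_length]
    simp
  have h2 : C.darts.countP (fun e => decide (e.symm ∈ C.darts)) = 0 := by
    rw [List.countP_eq_zero]
    intro e he
    rw [decide_eq_true_eq]
    intro he'
    have hnd : (C.darts.map Dart.edge).Nodup := hC.edges_nodup
    exact e.symm_ne (List.inj_on_of_nodup_map hnd he' he e.edge_symm)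
  rw [h1, h2] at h
  have h3 : C.darts.length ≠ 0 := by
    have := hC.three_le_length
    rw [Walk.length_darts]
    omega
  unfold SameDirection
  have h4 : W.darts.countP (fun e => decide (e.symm ∈ C.darts)) <
      W.darts.countP (fun e => decide (e ∈ C.darts)) := by omega
  convert! h4

theorem CyclesGE.mem_outerWalks {g : ℕ} (hg : CyclesGE G g) {v z : V} {C : G.Walk v v}
    (hC : C.IsCycle) {k l : ℕ} (hik : C.length + 2 * k < 2 * g) (hl : 1 ≤ l) (hlk : l ≤ k)
    {p : G.Walk z v} (hp : p.IsPath) (hpl : p.length = l)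
    (hpC : ∀ d ∈ p.darts, d.fst ∉ C.support) (hdist : G.dist z v = l) (hz : z ∉ C.support)
    {s : ℕ → ℕ} (hs : ∑ j ∈ Finset.range ((referenceWalk C p).length + 1), s j = k - l)
    {W : G.Walk z z} (hW : W ∈ blockWalks (referenceWalk C p) s) : W ∈ outerWalks C k l v z := by
  have hgC := hg C hC
  have hsj : ∀ j ≤ (referenceWalk C p).length, s j ≤ k - l := by
    intro j hj
    rw [← hs]
    exact Finset.single_le_sum (f := s) (fun _ _ => Nat.zero_le _)
      (Finset.mem_range.2 (Nat.lt_succ_of_le hj))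
  have hlen := length_of_mem_blockWalks hW
  rw [hs] at hlen
  have hRlen : (referenceWalk C p).length = C.length + 2 * l := by
    simp [referenceWalk, hpl]
    omega
  obtain ⟨hd, hflow⟩ := hg.blockWalks_flow_darts
    (fun j hj => by have := hsj j hj; omega) hW
  refine ⟨by omega, ⟨?_, ?_, ?_⟩, hz, hdist, C.start_mem_support, ?_⟩
  -- The darts of the reference walk persist in `W`, so the edges of the nonempty path `p` occur
  -- twice.
  · intro hcyc
    have h1 : (referenceWalk C p).edges.Nodup := (hd.map Dart.edge).nodup hcyc.edges_nodup
    rw [referenceWalk, Walk.edges_append, Walk.edges_append, Walk.edges_reverse] at h1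
    have hne : p.edges ≠ [] := by
      intro h
      rw [← Walk.length_edges, h] at hpl
      simp at hpl
      omega
    obtain ⟨e, he⟩ := List.exists_mem_of_ne_nil _ hne
    exact (List.disjoint_of_nodup_append h1) he (by simp [he])
  · refine List.Subset.trans ?_ (hd.map Dart.edge).subset
    change C.edges ⊆ (referenceWalk C p).edges
    intro e he
    simp [referenceWalk, he]
  · refine sameDirection_of_flow hC ?_
    rw [hflow _ (dartIndicator_symm _), referenceWalk, flow_conj (dartIndicator_symm _)]
  · have hs' : W ∈ blockWalks (referenceWalk C p) (fun j => min (s j) (k - l)) :=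
      blockWalks_congr (fun j hj => (min_eq_left (hsj j hj)).symm) hW
    obtain ⟨W₁, W₂, rfl, hW₁⟩ := hg.blockWalks_prefix (t := k - l) hC hik C.start_mem_support hp hpC
      (by omega) (fun j => min_le_right _ _) hs'
    refine ⟨W₁.length, by simp, ?_, fun m hm => ?_⟩
    · simpa using getVert_append_add W₁ W₂ 0
    · obtain ⟨d, hd, hdm⟩ := exists_dart_of_lt hm
      rw [getVert_append_left _ _ hm.le, ← hdm]
      exact hW₁ d hd

end ShortBlocks

/-! ### Counting closed walks by levels, in trees and in graphs of large girth. -/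

section Counting

/-- The number of walks of length `n` from level `h` to level `0`, in a graph where a vertex of level
`h` has one neighbour of level `h - 1` (if `h ≠ 0`) and `ch h` neighbours of level `h + 1`. -/
def levelCount (ch : ℕ → ℕ) : ℕ → ℕ → ℕ
  | 0, 0 => 1
  | 0, _ + 1 => 0
  | n + 1, 0 => ch 0 * levelCount ch n 1
  | n + 1, h + 1 => levelCount ch n h + ch (h + 1) * levelCount ch n (h + 2)

theorem levelCount_eq_zero (ch : ℕ → ℕ) {n h : ℕ} (hlt : n < h) : levelCount ch n h = 0 := by
  induction n generalizing h with
  | zero =>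
    obtain ⟨h, rfl⟩ := Nat.exists_eq_succ_of_ne_zero (by omega : h ≠ 0)
    rfl
  | succ n ih =>
    obtain ⟨h, rfl⟩ := Nat.exists_eq_succ_of_ne_zero (by omega : h ≠ 0)
    rw [Nat.succ_eq_add_one, levelCount, ih (by omega), ih (by omega), mul_zero, add_zero]

variable {V : Type*} {H : SimpleGraph V}

/-- A walk of length `n + 1` is a step followed by a walk of length `n`. -/
def walkSuccEquiv (H : SimpleGraph V) (u x : V) (n : ℕ) :
    {p : H.Walk u x // p.length = n + 1} ≃
      Σ v : H.neighborSet u, {p : H.Walk v x // p.length = n} where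
  toFun p := match p with
    | ⟨Walk.cons h p, hp⟩ => ⟨⟨_, h⟩, ⟨p, by simpa using hp⟩⟩
  invFun q := ⟨Walk.cons q.1.2 q.2.1, congrArg (· + 1) q.2.2⟩
  left_inv := by
    rintro ⟨p, hp⟩
    cases p with
    | nil => simp at hp
    | cons h p => rfl
  right_inv := by
    rintro ⟨⟨v, hv⟩, ⟨p, hp⟩⟩
    rfl

theorem finite_walks (hfin : ∀ u, (H.neighborSet u).Finite) (x : V) (n : ℕ) (u : V) :
    Finite {p : H.Walk u x // p.length = n} := by
  induction n generalizing u with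
  | zero =>
    refine @Finite.of_subsingleton _ ⟨?_⟩
    rintro ⟨p, hp⟩ ⟨q, hq⟩
    obtain rfl := Walk.eq_of_length_eq_zero hp
    rw [Subtype.mk.injEq, (Walk.length_eq_zero_iff.1 hp).eq_nil,
      (Walk.length_eq_zero_iff.1 hq).eq_nil]
  | succ n ih =>
    have := (hfin u).to_subtype
    exact Finite.of_equiv _ (walkSuccEquiv H u x n).symm

theorem ncard_walks_succ (hfin : ∀ u, (H.neighborSet u).Finite) (x u : V) (n : ℕ) :
    {p : H.Walk u x | p.length = n + 1}.ncard =
      ∑ v ∈ (hfin u).toFinset, {p : H.Walk v x | p.length = n}.ncard := by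
  have := finite_walks hfin x n
  have hf : Fintype (H.neighborSet u) := (hfin u).fintype
  have h1 : {p : H.Walk u x | p.length = n + 1}.ncard =
      Nat.card {p : H.Walk u x // p.length = n + 1} := rfl
  rw [h1, Nat.card_congr (walkSuccEquiv H u x n), Nat.card_sigma]
  rw [Finset.sum_subtype (p := fun v => v ∈ H.neighborSet u) _ (by simp)]
  rfl

theorem le_length_of_level {lev : V → ℕ} {S : Set V} {x : V}
    (hS : ∀ u ∈ S, ∀ v, H.Adj u v → v ∈ S) (h0 : ∀ u ∈ S, lev u = 0 ↔ u = x)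
    (hadj : ∀ u ∈ S, ∀ v, H.Adj u v → lev v = lev u + 1 ∨ lev v + 1 = lev u)
    {u : V} (hu : u ∈ S) (p : H.Walk u x) : lev u ≤ p.length := by
  induction p with
  | nil => simp [(h0 _ hu).2 rfl]
  | cons h p ih =>
    have h1 := ih h0 (hS _ hu _ h)
    have h2 := hadj _ hu _ h
    rw [Walk.length_cons]
    omega

/-- Both counts satisfy the same recursion on the first step. The branching is needed only up to
level `M / 2`: with `lev u + n ≤ M`, a walk from a higher level is too short to reach `x`. -/
theorem ncard_walks_eq_levelCount (hfin : ∀ u, (H.neighborSet u).Finite) {lev : V → ℕ} {S : Set V}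
    {x : V} {M : ℕ} {ch : ℕ → ℕ}
    (hS : ∀ u ∈ S, ∀ v, H.Adj u v → v ∈ S) (h0 : ∀ u ∈ S, lev u = 0 ↔ u = x)
    (hadj : ∀ u ∈ S, ∀ v, H.Adj u v → lev v = lev u + 1 ∨ lev v + 1 = lev u)
    (hup : ∀ u ∈ S, 2 * lev u ≤ M → {v | H.Adj u v ∧ lev v = lev u + 1}.ncard = ch (lev u))
    (hdown : ∀ u ∈ S, 2 * lev u ≤ M → u ≠ x → {v | H.Adj u v ∧ lev v + 1 = lev u}.ncard = 1)
    (n : ℕ) (u : V) (hu : u ∈ S) (hle : lev u + n ≤ M) :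
    {p : H.Walk u x | p.length = n}.ncard = levelCount ch n (lev u) := by
  classical
  induction n generalizing u with
  | zero =>
    by_cases hux : u = x
    · subst hux
      have : {p : H.Walk u u | p.length = 0} = {Walk.nil} := by
        ext p
        simp only [Set.mem_ofPred_eq, Set.mem_singleton_iff, Walk.length_eq_zero_iff,
          Walk.eq_nil_iff_nil]
      rw [this, (h0 u hu).2 rfl, Set.ncard_singleton, levelCount]
    · have hl : lev u ≠ 0 := fun h => hux ((h0 u hu).1 h)
      rw [levelCount_eq_zero ch (Nat.pos_of_ne_zero hl)]
      have : {p : H.Walk u x | p.length = 0} = ∅ := by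
        ext p
        simp only [Set.mem_ofPred_eq, Set.mem_empty_iff_false, iff_false]
        exact fun hp => hux (Walk.eq_of_length_eq_zero hp)
      rw [this, Set.ncard_empty]
  | succ n ih =>
    by_cases hbig : n + 1 < lev u
    · rw [levelCount_eq_zero ch hbig]
      have : {p : H.Walk u x | p.length = n + 1} = ∅ := by
        ext p
        simp only [Set.mem_ofPred_eq, Set.mem_empty_iff_false, iff_false]
        intro hp
        have := le_length_of_level hS h0 hadj hu p
        omega
      rw [this, Set.ncard_empty]
    have hU := hup u hu (by omega)
    rw [ncard_walks_succ hfin, ← Finset.sum_filter_add_sum_filter_not _ (fun v => lev v = lev u + 1)]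
    have h1 : ∑ v ∈ (hfin u).toFinset with lev v = lev u + 1,
        {p : H.Walk v x | p.length = n}.ncard = ch (lev u) * levelCount ch n (lev u + 1) := by
      rw [Finset.sum_congr rfl (g := fun _ => levelCount ch n (lev u + 1)), Finset.sum_const,
        smul_eq_mul, ← hU]
      · congr 1
        rw [← Set.ncard_coe_finset]
        congr 1
        ext v
        simp
      · intro v hv
        simp only [Finset.mem_filter, Set.Finite.mem_toFinset, mem_neighborSet] at hv
        rw [ih v (hS u hu v hv.1) (by omega), hv.2]
    rw [h1]
    by_cases hux : u = x
    · have hl := (h0 u hu).2 hux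
      rw [Finset.filter_false_of_mem, Finset.sum_empty, hl, levelCount]
      · simp
      · intro v hv
        simp only [Set.Finite.mem_toFinset, mem_neighborSet] at hv
        have := hadj u hu v hv
        omega
    · have hl : lev u ≠ 0 := fun h => hux ((h0 u hu).1 h)
      have hD := hdown u hu (by omega) hux
      obtain ⟨h, hh⟩ := Nat.exists_eq_succ_of_ne_zero hl
      have h2 : ∑ v ∈ (hfin u).toFinset with ¬ lev v = lev u + 1,
          {p : H.Walk v x | p.length = n}.ncard = levelCount ch n h := by
        rw [Finset.sum_congr rfl (g := fun _ => levelCount ch n h), Finset.sum_const,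
          smul_eq_mul]
        · conv_rhs => rw [← one_mul (levelCount ch n h), ← hD]
          congr 1
          rw [← Set.ncard_coe_finset]
          congr 1
          ext v
          simp only [Finset.coe_filter, Set.Finite.mem_toFinset, mem_neighborSet, Set.mem_ofPred_eq]
          refine and_congr_right fun hv => ?_
          have := hadj u hu v hv
          omega
        · intro v hv
          simp only [Finset.mem_filter, Set.Finite.mem_toFinset, mem_neighborSet] at hv
          have := hadj u hu v hv.1
          have hlv : lev v = h := by omega
          rw [ih v (hS u hu v hv.1) (by omega), hlv]
      rw [h2, hh, Nat.succ_eq_add_one, levelCount]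
      ring

/-- The level is the distance to `x`. Parity keeps neighbours off the same level, and two downward
neighbours would give two shortest paths of total length at most `M < g`. Restriction to reachable
vertices matters, since an unreachable one has `dist` 0. -/
theorem ncard_closed_walks_eq_levelCount (hfin : ∀ u, (H.neighborSet u).Finite) {g M : ℕ}
    (hg : CyclesGE H g) (hpar : ∀ (y : V) (W : H.Walk y y), Even W.length) (hM : M < g) {x : V}
    {ch : ℕ → ℕ} (hroot : (H.neighborSet x).ncard = ch 0)
    (hdeg : ∀ u, H.Reachable u x → 2 * H.dist u x ≤ M → u ≠ x →
      (H.neighborSet u).ncard = ch (H.dist u x) + 1) :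
    {p : H.Walk x x | p.length = M}.ncard = levelCount ch M 0 := by
  have h0 : ∀ u ∈ {u | H.Reachable u x}, H.dist u x = 0 ↔ u = x := fun u hu =>
    Reachable.dist_eq_zero_iff hu
  have hadj : ∀ u ∈ {u | H.Reachable u x}, ∀ v, H.Adj u v →
      H.dist v x = H.dist u x + 1 ∨ H.dist v x + 1 = H.dist u x := by
    intro u hu v huv
    have hv : H.Reachable v x := huv.symm.reachable.trans hu
    obtain ⟨P, hP⟩ := Reachable.exists_walk_length_eq_dist hu
    obtain ⟨Q, hQ⟩ := Reachable.exists_walk_length_eq_dist hv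
    have h1 := dist_le (Walk.cons huv Q)
    have h2 := dist_le (Walk.cons huv.symm P)
    have h3 := hpar _ ((Walk.cons huv Q).append P.reverse)
    rw [Walk.length_append, Walk.length_reverse, Walk.length_cons, hP, hQ] at h3
    rw [Walk.length_cons, hQ] at h1
    rw [Walk.length_cons, hP] at h2
    have h4 : H.dist v x ≠ H.dist u x := by
      intro h
      rw [h] at h3
      obtain ⟨r, hr⟩ := h3
      omega
    omega
  have hdown : ∀ u ∈ {u | H.Reachable u x}, 2 * H.dist u x ≤ M → u ≠ x →
      {v | H.Adj u v ∧ H.dist v x + 1 = H.dist u x}.ncard = 1 := by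
    intro u hu hle hux
    rw [Set.ncard_eq_one]
    obtain ⟨P, hP⟩ := Reachable.exists_walk_length_eq_dist hu
    cases P with
    | nil => exact absurd rfl hux
    | @cons _ v _ h P =>
      have hPp := Walk.isPath_of_length_eq_dist _ hP
      refine ⟨v, ?_⟩
      ext w
      simp only [Set.mem_ofPred_eq, Set.mem_singleton_iff]
      constructor
      · rintro ⟨hw1, hw2⟩
        obtain ⟨Q, hQ⟩ := Reachable.exists_walk_length_eq_dist
          (hw1.symm.reachable.trans hu : H.Reachable w x)
        have hQ' : (Walk.cons hw1 Q).length = H.dist u x := by rw [Walk.length_cons, hQ, hw2]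
        have := hg.path_eq (Walk.isPath_of_length_eq_dist _ hQ') hPp (by omega)
        rw [Walk.cons.injEq] at this
        exact this.1
      · rintro rfl
        refine ⟨h, ?_⟩
        have h1 := hadj u hu w h
        have h2 := dist_le P
        rw [Walk.length_cons] at hP
        omega
  have hup : ∀ u ∈ {u | H.Reachable u x}, 2 * H.dist u x ≤ M →
      {v | H.Adj u v ∧ H.dist v x = H.dist u x + 1}.ncard = ch (H.dist u x) := by
    intro u hu hle
    by_cases hux : u = x
    · subst hux
      rw [dist_self, ← hroot]
      congr 1
      ext v
      simp only [Set.mem_ofPred_eq, mem_neighborSet, zero_add, and_iff_left_iff_imp]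
      intro huv
      have := hadj u hu v huv
      rw [dist_self] at this
      omega
    · have h1 := hdeg u hu hle hux
      have h2 := hdown u hu hle hux
      have h3 : H.neighborSet u = {v | H.Adj u v ∧ H.dist v x = H.dist u x + 1} ∪
          {v | H.Adj u v ∧ H.dist v x + 1 = H.dist u x} := by
        ext v
        simp only [mem_neighborSet, Set.mem_union, Set.mem_ofPred_eq, ← and_or_left]
        exact ⟨fun h => ⟨h, hadj u hu v h⟩, fun h => h.1⟩
      rw [h3, Set.ncard_union_eq _ ((hfin u).subset fun v hv => hv.1)
        ((hfin u).subset fun v hv => hv.1), h2] at h1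
      · omega
      · rw [Set.disjoint_left]
        rintro v ⟨-, hv1⟩ ⟨-, hv2⟩
        omega
  have := ncard_walks_eq_levelCount hfin (S := {u | H.Reachable u x}) (M := M)
    (fun u hu v huv => huv.symm.reachable.trans hu) h0 hadj hup hdown M x
    (Reachable.refl x) (by simp)
  simpa using this

/-- The numbers of children in the related tree. -/
def treeBranching (c d h : ℕ) : ℕ := if Even h then c - 1 else d - 1

/-- At a longest word on a cycle, both neighbours along the cycle would be its unique parent. -/
theorem relatedTree_isAcyclic (c d : ℕ) : (relatedTree c d).IsAcyclic := by
  classical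
  intro v C hC
  obtain ⟨x, hx, hmax⟩ := C.support.toFinset.exists_max_image (fun w => w.1.length)
    ⟨v, by simp⟩
  rw [List.mem_toFinset] at hx
  have hR := hC.rotate hx
  have hparent : ∀ y ∈ (C.rotate x hx).support, (relatedTree c d).Adj x y → x.1.tail = y.1 := by
    rintro y hy (⟨a, ha⟩ | ⟨a, ha⟩)
    · rw [Walk.mem_support_rotate_iff] at hy
      have := hmax y (by simpa using hy)
      rw [ha, List.length_cons] at this
      omega
    · rw [ha, List.tail_cons]
  refine hR.snd_ne_penultimate (Subtype.ext ?_)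
  rw [← hparent _ (Walk.getVert_mem_support _ _) (Walk.adj_snd hR.not_nil),
    ← hparent _ (Walk.getVert_mem_support _ _) (Walk.adj_penultimate hR.not_nil).symm]

/-- The children of a vertex of the related tree. -/
def treeChild {c d : ℕ} (u : TreeVertex c d) (a : Fin (treeBranching c d u.1.length)) :
    TreeVertex c d := ⟨a :: u.1, u.2, a.2⟩

theorem treeChild_injective {c d : ℕ} (u : TreeVertex c d) : Function.Injective (treeChild u) := by
  intro a b hab
  exact Fin.ext (List.cons.inj (congrArg Subtype.val hab)).1

theorem setOf_up_eq_range {c d : ℕ} (u : TreeVertex c d) :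
    {v | (relatedTree c d).Adj u v ∧ v.1.length = u.1.length + 1} = Set.range (treeChild u) := by
  ext v
  constructor
  · rintro ⟨⟨a, ha⟩ | ⟨a, ha⟩, hl⟩
    · have hv := v.2
      rw [ha] at hv
      exact ⟨⟨a, hv.2⟩, Subtype.ext ha.symm⟩
    · rw [ha, List.length_cons] at hl
      omega
  · rintro ⟨a, rfl⟩
    exact ⟨Or.inl ⟨a, rfl⟩, rfl⟩

theorem ncard_tree_walks (c d n : ℕ) :
    {p : (relatedTree c d).Walk (treeRoot c d) (treeRoot c d) | p.length = n}.ncard =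
      levelCount (treeBranching c d) n 0 := by
  have hdownset : ∀ u : TreeVertex c d, u ≠ treeRoot c d → ∃ t,
      {v | (relatedTree c d).Adj u v ∧ v.1.length + 1 = u.1.length} = {t} := by
    rintro ⟨u, hu⟩ hne
    cases u with
    | nil => exact absurd rfl hne
    | cons a u =>
      refine ⟨⟨u, hu.1⟩, ?_⟩
      ext v
      constructor
      · rintro ⟨⟨b, hb⟩ | ⟨b, hb⟩, hl⟩
        · rw [hb] at hl
          simp at hl
          omega
        · exact Subtype.ext (List.cons.inj hb).2.symm
      · rintro rfl
        exact ⟨Or.inr ⟨a, rfl⟩, rfl⟩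
  have hadj : ∀ u v : TreeVertex c d, (relatedTree c d).Adj u v →
      v.1.length = u.1.length + 1 ∨ v.1.length + 1 = u.1.length := by
    rintro u v (⟨a, ha⟩ | ⟨a, ha⟩)
    · left; rw [ha]; rfl
    · right; rw [ha]; rfl
  have hfinup : ∀ u : TreeVertex c d,
      {v | (relatedTree c d).Adj u v ∧ v.1.length = u.1.length + 1}.Finite := by
    intro u
    rw [setOf_up_eq_range]
    exact Set.finite_range _
  have hfin : ∀ u, ((relatedTree c d).neighborSet u).Finite := by
    intro u
    have h1 : {v | (relatedTree c d).Adj u v ∧ v.1.length + 1 = u.1.length}.Finite := by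
      by_cases hu : u = treeRoot c d
      · subst hu
        refine Set.Finite.subset Set.finite_empty fun v hv => ?_
        have := hv.2
        simp [treeRoot] at this
      · obtain ⟨t, ht⟩ := hdownset u hu
        rw [ht]
        exact Set.finite_singleton t
    refine ((hfinup u).union h1).subset fun v hv => ?_
    rcases hadj u v hv with h | h
    · exact Or.inl ⟨hv, h⟩
    · exact Or.inr ⟨hv, h⟩
  have := ncard_walks_eq_levelCount hfin (lev := fun u => u.1.length) (S := Set.univ)
    (x := treeRoot c d) (M := n) (ch := treeBranching c d) (fun _ _ _ _ => trivial)
    (fun u _ => by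
      rw [List.length_eq_zero_iff]
      exact ⟨fun h => Subtype.ext h, fun h => by rw [h]; rfl⟩)
    (fun u _ v => hadj u v)
    (fun u _ _ => by
      rw [setOf_up_eq_range, ← Set.image_univ,
        Set.ncard_image_of_injective _ (treeChild_injective u), Set.ncard_univ, Nat.card_fin])
    (fun u _ _ hu => by
      obtain ⟨t, ht⟩ := hdownset u hu
      rw [ht, Set.ncard_singleton])
    n (treeRoot c d) trivial (by simp [treeRoot])
  simpa [treeRoot] using this

theorem cycleFreeCount_of_isAcyclic (hH : H.IsAcyclic) (x : V) (n : ℕ) :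
    cycleFreeCount H x n = {p : H.Walk x x | p.length = n}.ncard := by
  unfold cycleFreeCount cycleFreeWalks
  congr 1
  ext p
  simp only [Set.mem_ofPred_eq, and_iff_left_iff_imp]
  intro _
  refine hH.anti fun a b hab => ?_
  rw [fromEdgeSet_adj] at hab
  exact p.edges_subset_edgeSet hab.1

theorem treeCount_eq (c d n : ℕ) : treeCount c d n = levelCount (treeBranching c d) n 0 := by
  rw [treeCount, cycleFreeCount_of_isAcyclic (relatedTree_isAcyclic c d), ncard_tree_walks]

theorem CyclesGE.cycleFreeCount_eq {g : ℕ} (hg : CyclesGE H g) (x : V) {n : ℕ} (hn : n < g) :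
    cycleFreeCount H x n = {p : H.Walk x x | p.length = n}.ncard := by
  unfold cycleFreeCount cycleFreeWalks
  congr 1
  ext p
  simp only [Set.mem_ofPred_eq, and_iff_left_iff_imp]
  rintro rfl
  exact hg.isAcyclic_of_length_lt (fun e he => p.edges_subset_edgeSet he) (by simpa using hn)

end Counting

/-! ### Counting blocks in a biregular graph. -/

section BlockCounts

variable {V : Type*} [Fintype V] {G : SimpleGraph V} [DecidableRel G.Adj] {A B : Set V} {c d : ℕ}

/-- Degrees can be followed without naming the part: a vertex with the degree of the other part
forces `c = d`. -/
theorem IsBiregular.degree_of_adj (hG : IsBiregular G A B c d) {u v : V} (h : G.Adj u v) :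
    (G.degree u = c → G.degree v = d) ∧ (G.degree u = d → G.degree v = c) := by
  rcases hG.bipartite.mem_of_adj h with ⟨hu, hv⟩ | ⟨hu, hv⟩
  · have h1 := hG.degree_left u hu
    have h2 := hG.degree_right v hv
    exact ⟨fun _ => h2, fun _ => by omega⟩
  · have h1 := hG.degree_right u hu
    have h2 := hG.degree_left v hv
    exact ⟨fun _ => by omega, fun _ => h2⟩

theorem IsBiregular.swap (hG : IsBiregular G A B c d) : IsBiregular G B A d c :=
  ⟨hG.bipartite.symm, by rw [Set.union_comm]; exact hG.cover, hG.degree_right, hG.degree_left⟩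

theorem IsBiregular.degree_of_walk (hG : IsBiregular G A B c d) {u v : V} (W : G.Walk u v) :
    (G.degree u = c → G.degree v = if Even W.length then c else d) ∧
      (G.degree u = d → G.degree v = if Even W.length then d else c) := by
  induction W with
  | nil => simp
  | cons h p ih =>
    have h1 := hG.degree_of_adj h
    simp only [Walk.length_cons, Nat.even_add_one, ite_not]
    exact ⟨fun hu => ih.2 (h1.1 hu), fun hu => ih.1 (h1.2 hu)⟩

theorem IsBiregular.even_length (hG : IsBiregular G A B c d) {u : V} (W : G.Walk u u) :
    Even W.length :=
  two_colorable_iff_forall_loop_even.1 hG.bipartite.isBipartite u W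

theorem ncard_neighborSet (u : V) : (G.neighborSet u).ncard = G.degree u := by
  rw [← card_neighborSet_eq_degree, ← Nat.card_eq_fintype_card]
  rfl

/-- The numbers of children in the tree with root of degree `c` whose vertices of level
`1, 2, 3, …` have degrees `d, c, d, …`. -/
def fullBranching (c d h : ℕ) : ℕ := if h = 0 then c else treeBranching c d h

theorem IsBiregular.ncard_closed_walks (hG : IsBiregular G A B c d) {g : ℕ} (hg : CyclesGE G g)
    {x : V} (hx : G.degree x = c) {n : ℕ} (hn : n < g) :
    {p : G.Walk x x | p.length = n}.ncard = levelCount (fullBranching c d) n 0 := by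
  refine ncard_closed_walks_eq_levelCount (fun u => Set.toFinite _) hg
    (fun _ W => hG.even_length W) hn ?_ ?_
  · rw [ncard_neighborSet, hx]
    rfl
  · intro u hu _ hux
    obtain ⟨P, hP⟩ := hu.exists_walk_length_eq_dist
    have h1 := (hG.degree_of_walk P.reverse).1 hx
    rw [Walk.length_reverse, hP] at h1
    have h2 : G.dist u x ≠ 0 := fun h => hux (hu.dist_eq_zero_iff.1 h)
    have h3 : 0 < G.degree u := by
      cases P with
      | nil => exact absurd rfl hux
      | cons h P => exact (G.degree_pos_iff_exists_adj u).2 ⟨_, h⟩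
    rw [ncard_neighborSet, fullBranching, if_neg h2, treeBranching]
    split_ifs at h1 ⊢ <;> omega

theorem notMem_support_deleteIncidenceSet {V : Type*} {G : SimpleGraph V} {w u v : V} (hu : u ≠ w)
    (q : (G.deleteIncidenceSet w).Walk u v) : w ∉ q.support := by
  induction q with
  | nil => simpa using hu.symm
  | cons h p ih =>
    rw [deleteIncidenceSet_adj] at h
    rw [Walk.support_cons, List.mem_cons, not_or]
    exact ⟨hu.symm, ih h.2.2⟩

/-- Isolating `w` takes one neighbour from `u`, which gives the root degree `c - 1`. Any other
vertex within distance `s` keeps its degree: if it were adjacent to `w`, there would be a second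
path from `w` to `u` of length at most `s + 1`. -/
theorem IsBiregular.ncard_closed_walks_deleteIncidenceSet (hG : IsBiregular G A B c d) {g : ℕ}
    (hg : CyclesGE G g) {u w : V} (huw : G.Adj u w) (hu : G.degree u = c) {s : ℕ}
    (hs : 2 * s + 2 < g) :
    {p : (G.deleteIncidenceSet w).Walk u u | p.length = 2 * s}.ncard = treeCount c d (2 * s) := by
  classical
  rw [treeCount_eq]
  have hle : G.deleteIncidenceSet w ≤ G := G.deleteIncidenceSet_le w
  have hc : 0 < c := hu ▸ (G.degree_pos_iff_exists_adj u).2 ⟨w, huw⟩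
  have hd : 0 < d := by
    rw [← (hG.degree_of_adj huw).1 hu]
    exact (G.degree_pos_iff_exists_adj w).2 ⟨u, huw.symm⟩
  refine ncard_closed_walks_eq_levelCount (fun u => Set.toFinite _) (hg.anti hle)
    (fun _ W => by simpa using hG.even_length (W.mapLe hle)) (by omega) ?_ ?_
  · have h1 : (G.deleteIncidenceSet w).neighborSet u = G.neighborSet u \ {w} := by
      ext v
      simp [deleteIncidenceSet_adj, huw.ne]
    rw [h1, Set.ncard_sdiff_singleton_of_mem (show w ∈ G.neighborSet u from huw), ncard_neighborSet, hu]
    simp [treeBranching]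
  · intro y hy hys hyu
    obtain ⟨P, hP⟩ := hy.exists_walk_length_eq_dist
    have hPp := Walk.isPath_of_length_eq_dist _ hP
    have hw : w ∉ P.support := by
      have := notMem_support_deleteIncidenceSet huw.ne P.reverse
      simpa using this
    have hyw : ¬ G.Adj w y := by
      intro hwy
      have := hg.path_eq (P := Walk.cons hwy (P.mapLe hle)) (Q := Walk.cons huw.symm Walk.nil)
        (by
          rw [Walk.cons_isPath_iff]
          exact ⟨hPp.mapLe hle, by simpa using hw⟩)
        (by simp [huw.ne.symm])
        (by simp; omega)
      rw [Walk.cons.injEq] at this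
      exact hyu this.1
    have hyw' : y ≠ w := by
      rintro rfl
      exact hw P.start_mem_support
    have h1 : (G.deleteIncidenceSet w).neighborSet y = G.neighborSet y := by
      ext v
      simp only [mem_neighborSet, deleteIncidenceSet_adj, and_iff_left_iff_imp]
      intro h
      refine ⟨hyw', ?_⟩
      rintro rfl
      exact hyw h.symm
    have h2 := (hG.degree_of_walk (P.mapLe hle).reverse).1 hu
    rw [Walk.length_reverse, Walk.length_map, hP] at h2
    rw [h1, ncard_neighborSet, h2, treeBranching]
    split_ifs <;> omega

theorem IsBiregular.ncard_firstPassage (hG : IsBiregular G A B c d) {g : ℕ}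
    (hg : CyclesGE G g) {u w : V} (huw : G.Adj u w) (hu : G.degree u = c) {s : ℕ}
    (hs : 2 * s + 2 < g) : (firstPassage G u w (2 * s + 1)).ncard = treeCount c d (2 * s) := by
  rw [← hG.ncard_closed_walks_deleteIncidenceSet hg huw hu hs]
  have hle : G.deleteIncidenceSet w ≤ G := G.deleteIncidenceSet_le w
  rw [← Set.ncard_image_of_injective _
    (f := fun q : (G.deleteIncidenceSet w).Walk u u =>
      (q.mapLe hle).append (Walk.cons huw Walk.nil))]
  · congr 1
    ext p
    constructor
    · intro hp
      obtain ⟨A₀, rfl, hlen, hw⟩ := hg.firstPassage_eq huw hs hp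
      have hA₀ : ∀ e ∈ A₀.edges, e ∈ (G.deleteIncidenceSet w).edgeSet := by
        intro e he
        induction e using Sym2.ind with
        | _ a b =>
          rw [mem_edgeSet, deleteIncidenceSet_adj]
          refine ⟨A₀.adj_of_mem_edges he, ?_, ?_⟩
          · rintro rfl
            exact hw (A₀.fst_mem_support_of_mem_edges he)
          · rintro rfl
            exact hw (A₀.snd_mem_support_of_mem_edges he)
      refine ⟨A₀.transfer _ hA₀, by simpa using hlen, ?_⟩
      have : (A₀.transfer _ hA₀).mapLe hle = A₀ := by
        apply Walk.edges_injective
        simp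
      simp only [this]
    · rintro ⟨q, hq, rfl⟩
      refine append_mem_firstPassage huw (by simpa using hq) ?_
      simpa using notMem_support_deleteIncidenceSet huw.ne q
  · intro q q' h
    simp only [← Walk.concat_eq_append] at h
    obtain ⟨_, h⟩ := Walk.concat_inj h
    exact Walk.map_injective_of_injective (fun _ _ h => h) _ _ (by simpa using h)

/-- Cutting at the first passage is unique, so the counts multiply. Each step of `R` exchanges the
roles of `c` and `d`, hence the induction over all of `A`, `B`, `c`, `d`. -/
theorem IsBiregular.ncard_blockWalks (hG : IsBiregular G A B c d) {g : ℕ}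
    (hg : CyclesGE G g) {u v : V} (R : G.Walk u v) {s : ℕ → ℕ} (hu : G.degree u = c)
    (hs : ∀ j < R.length, 2 * s j + 2 < g) :
    (blockWalks R s).ncard = {p : G.Walk v v | p.length = 2 * s R.length}.ncard *
      ∏ j ∈ Finset.range R.length,
        if Even j then treeCount c d (2 * s j) else treeCount d c (2 * s j) := by
  induction R generalizing s c d A B with
  | nil => simp [blockWalks]
  | @cons u w v h R ih =>
    have himage : blockWalks (Walk.cons h R) s =
        (fun x : G.Walk u w × G.Walk w v => x.1.append x.2) ''
          (firstPassage G u w (2 * s 0 + 1) ×ˢ blockWalks R (fun j => s (j + 1))) := by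
      ext W
      rw [mem_blockWalks_cons]
      constructor
      · rintro ⟨A, hA, B, hB, rfl⟩
        exact ⟨(A, B), ⟨hA, hB⟩, rfl⟩
      · rintro ⟨⟨A, B⟩, ⟨hA, hB⟩, rfl⟩
        exact ⟨A, hA, B, hB, rfl⟩
    rw [himage, Set.InjOn.ncard_image, Set.ncard_prod,
      hG.ncard_firstPassage hg h hu (hs 0 (by simp)),
      ih hG.swap ((hG.degree_of_adj h).1 hu) (fun j hj => hs (j + 1) (by simpa using hj)),
      Walk.length_cons, Finset.prod_range_succ']
    · simp only [Even.zero, if_true, Nat.even_add_one, ite_not]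
      ring
    · rintro ⟨A₁, B₁⟩ ⟨hA₁, -⟩ ⟨A₂, B₂⟩ ⟨hA₂, -⟩ heq
      obtain ⟨h1, h2⟩ := firstPassage_unique hA₁ hA₂ heq
      exact Prod.ext h1 h2

theorem prod_range_two_mul (F : ℕ → ℕ) (m : ℕ) :
    ∏ j ∈ Finset.range (2 * m), F j = ∏ j ∈ Finset.range m, F (2 * j) * F (2 * j + 1) := by
  induction m with
  | zero => simp
  | succ m ih =>
    rw [Nat.mul_succ, Finset.prod_range_succ, Finset.prod_range_succ, ih, Finset.prod_range_succ,
      mul_assoc]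

theorem prod_range_eq_treeProduct {i l : ℕ} (hi : Even i) (s : Fin (i + 2 * l + 1) → ℕ) :
    ∏ j ∈ Finset.range (i + 2 * l), (if Even j then treeCount c d (2 * extendZero s j)
      else treeCount d c (2 * extendZero s j)) = treeProduct c d i l s := by
  have h : i + 2 * l = 2 * (i / 2 + l) := by
    obtain ⟨r, rfl⟩ := hi
    omega
  have key : ∀ (N : ℕ) (F : ℕ → ℕ), N = 2 * (i / 2 + l) → ∏ j ∈ Finset.range N, F j =
      ∏ j : Fin (i / 2 + l), F (2 * j) * F (2 * j + 1) := by
    rintro N F rfl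
    rw [prod_range_two_mul, Finset.prod_range]
  rw [key _ _ h, treeProduct]
  refine Finset.prod_congr rfl fun j _ => ?_
  have hj := j.2
  rw [if_pos (even_two_mul _), if_neg (by simp), extendZero_of_lt s (by omega),
    extendZero_of_lt s (by omega)]

end BlockCounts

end BiregularWalks

/-! ### The theorem. -/

open BiregularWalks in
theorem mainTheorem2 {V : Type*} [Fintype V] (G : SimpleGraph V) [DecidableRel G.Adj]
    (A B : Set V) (c d : ℕ) (hG : BiregularWalks.IsBiregular G A B c d)
    (i k l : ℕ) (v₀ : V) (C : G.Walk v₀ v₀) (hC : C.IsCycle) (hi : C.length = i)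
    (hv₀ : G.degree v₀ = c) (hik : i + 2 * k < 2 * G.girth) (hl : 1 ≤ l) (hlk : l ≤ k)
    (z₀ : V) (hz₀ : z₀ ∈ BiregularWalks.outerVertices C k l v₀)
    (p : G.Walk z₀ v₀) (hp : p.IsPath) (hpl : p.length = l) :
    -- the count for a fixed composition, `l` even and `l` odd
    (Even l → ∀ x : V, G.degree x = c →
      ∀ s : Fin (i + 2 * l + 1) → ℕ, ∑ j, s j = k - l →
        (BiregularWalks.outerWalksWithBlocks C p k l s).ncard =
          BiregularWalks.cycleFreeCount G x (2 * s (Fin.last (i + 2 * l))) *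
            BiregularWalks.treeProduct c d i l s) ∧
    (Odd l → ∀ x : V, G.degree x = d →
      ∀ s : Fin (i + 2 * l + 1) → ℕ, ∑ j, s j = k - l →
        (BiregularWalks.outerWalksWithBlocks C p k l s).ncard =
          BiregularWalks.cycleFreeCount G x (2 * s (Fin.last (i + 2 * l))) *
            BiregularWalks.treeProduct d c i l s) ∧
    -- the decomposition over all compositions
    (BiregularWalks.outerWalks C k l v₀ z₀ =
      ⋃ s ∈ {s : Fin (i + 2 * l + 1) → ℕ | ∑ j, s j = k - l},
        BiregularWalks.outerWalksWithBlocks C p k l s) ∧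
    (BiregularWalks.outerWalks C k l v₀ z₀).ncard =
      ∑ s ∈ Finset.Nat.antidiagonalTuple (i + 2 * l + 1) (k - l),
        (BiregularWalks.outerWalksWithBlocks C p k l s).ncard := by
  classical
  subst hi
  have hg := cyclesGE_girth G
  have hgC := hg C hC
  have hRlen : (referenceWalk C p).length = C.length + 2 * l := by
    simp [referenceWalk, hpl]
    omega
  obtain ⟨W₀, hW₀⟩ := hz₀
  -- A single witness for `z₀ ∈ N_l(v₀)` already shows that `p` meets the cycle only at `v₀`.
  have hpC := (hg.reduct_eq_referenceWalk hC hik hp (by omega) hW₀.1 hW₀.2.1 hW₀.2.2.2.2).2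
  have hblocks : ∀ s : Fin (C.length + 2 * l + 1) → ℕ, ∑ j, s j = k - l →
      outerWalksWithBlocks C p k l s = blockWalks (referenceWalk C p) (extendZero s) := by
    intro s hs
    ext W
    constructor
    · rintro ⟨-, h⟩
      exact (hasBlocks_iff hRlen s).1 h
    · intro h
      refine ⟨hg.mem_outerWalks hC hik hl hlk hp hpl hpC hW₀.2.2.2.1 hW₀.2.2.1 ?_ h,
        (hasBlocks_iff hRlen s).2 h⟩
      rw [hRlen, sum_extendZero, hs]
  -- From `hgC` and `hik` comes `2 * k < G.girth`, and `1 ≤ l` leaves room for the extra 2.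
  have hsmall : ∀ s : Fin (C.length + 2 * l + 1) → ℕ, ∑ j, s j = k - l →
      ∀ j, 2 * s j + 2 < G.girth := by
    intro s hs j
    have := Finset.single_le_sum (f := s) (fun _ _ => Nat.zero_le _) (Finset.mem_univ j)
    omega
  have hcount : ∀ (A' B' : Set V) (c' d' : ℕ), IsBiregular G A' B' c' d' → G.degree z₀ = c' →
      ∀ x : V, G.degree x = c' → ∀ s : Fin (C.length + 2 * l + 1) → ℕ, ∑ j, s j = k - l →
        (outerWalksWithBlocks C p k l s).ncard =
          cycleFreeCount G x (2 * s (Fin.last (C.length + 2 * l))) *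
            treeProduct c' d' C.length l s := by
    intro A' B' c' d' hG' hz x hx s hs
    have hlast := hsmall s hs (Fin.last (C.length + 2 * l))
    rw [hblocks s hs, hG'.ncard_blockWalks hg _ hz, hRlen,
      prod_range_eq_treeProduct (hG.even_length C), hg.cycleFreeCount_eq x (by omega),
      -- The last block is based at `z₀`, but below the girth the number of closed walks depends
      -- only on the degree, so any `x` of that degree serves.
      hG'.ncard_closed_walks hg hx (by omega)]
    · have he : extendZero s (C.length + 2 * l) = s (Fin.last (C.length + 2 * l)) :=
        extendZero_of_lt s (Nat.lt_succ_self _)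
      rw [he, hG'.ncard_closed_walks hg hz (by omega)]
    · intro j hj
      rw [hRlen] at hj
      rw [extendZero_of_lt s (by omega)]
      exact hsmall s hs _
  have hdeg := (hG.degree_of_walk p.reverse).1 hv₀
  rw [SimpleGraph.Walk.length_reverse, hpl] at hdeg
  have hunion : outerWalks C k l v₀ z₀ =
      ⋃ s ∈ {s : Fin (C.length + 2 * l + 1) → ℕ | ∑ j, s j = k - l},
        outerWalksWithBlocks C p k l s := by
    ext W
    simp only [Set.mem_iUnion]
    constructor
    · intro hW
      have hred := (hg.reduct_eq_referenceWalk hC hik hp (by omega) hW.1 hW.2.1 hW.2.2.2.2).1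
      -- Reduction only deletes darts, so the vertices of the reference walk occur in `W` in order.
      obtain ⟨s, hs⟩ := exists_mem_blockWalks (fun _ W => hG.even_length W) hred.support.tail
      have hlen := length_of_mem_blockWalks hs
      rw [hRlen, hW.1] at hlen
      have hs' : W ∈ blockWalks (referenceWalk C p)
          (extendZero fun j : Fin (C.length + 2 * l + 1) => s j) :=
        blockWalks_congr (fun j hj =>
          (extendZero_of_lt (fun j : Fin (C.length + 2 * l + 1) => s j)
            (Nat.lt_succ_of_le (hRlen ▸ hj))).symm) hs
      refine ⟨fun j => s j, ?_, hW, (hasBlocks_iff hRlen _).2 hs'⟩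
      change ∑ j : Fin (C.length + 2 * l + 1), s j = k - l
      rw [← Finset.sum_range]
      omega
    · rintro ⟨s, -, hW⟩
      exact hW.1
  refine ⟨fun heven x hx s hs => hcount A B c d hG (by rw [hdeg, if_pos heven]) x hx s hs,
    fun hodd x hx s hs => hcount B A d c hG.swap
      (by rw [hdeg, if_neg (Nat.not_even_iff_odd.2 hodd)]) x hx s hs, hunion, ?_⟩
  have hfin : ∀ s, (outerWalksWithBlocks (N := C.length + 2 * l) C p k l s).Finite := by
    intro s
    have := finite_walks (H := G) (fun u => Set.toFinite _) z₀ (C.length + 2 * k) z₀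
    exact Set.Finite.subset (s := {W : G.Walk z₀ z₀ | W.length = C.length + 2 * k})
      (Set.toFinite _) fun W hW => hW.1.1
  have hcoe : outerWalks C k l v₀ z₀ =
      ((Finset.Nat.antidiagonalTuple (C.length + 2 * l + 1) (k - l)).biUnion
        fun s => (hfin s).toFinset : Finset (G.Walk z₀ z₀)) := by
    rw [hunion]
    ext W
    simp [Finset.Nat.mem_antidiagonalTuple]
  rw [hcoe, Set.ncard_coe_finset, Finset.card_biUnion]
  · refine Finset.sum_congr rfl fun s _ => ?_
    rw [Set.ncard_eq_toFinset_card _ (hfin s)]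
  -- Block lengths are determined by the walk, so the union is disjoint.
  · intro s hs s' hs' hne
    rw [Function.onFun, Finset.disjoint_left]
    intro W hW hW'
    rw [Set.Finite.mem_toFinset] at hW hW'
    refine hne (funext fun j => ?_)
    have h1 := blockWalks_unique ((hasBlocks_iff hRlen s).1 hW.2)
      ((hasBlocks_iff hRlen s').1 hW'.2) j (by rw [hRlen]; exact Nat.lt_succ_iff.1 j.2)
    rwa [extendZero_of_lt s j.2, extendZero_of_lt s' j.2] at h1
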